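/- Let $\beta_k\ge 0$ ($k=1,2,\dots$) be rates with $\sum_{k\ge1}k^2\beta_k<\infty$, and let $\{\mathcal D_i^k: i\in\mathbf Z,\ k\ge 1\}$ be mutually independent homogeneous Poisson point processes on $[0,\infty)$, $\mathcal D_i^k$ having rate $\beta_k$. Let $\xi=(\xi(i,t): i\in\mathbf Z,\ t\ge 0)$, where $\xi(i,t)\in\mathbf Z\cup\{\infty\}$ is the location of particle $i$ at time $t$, be the totally asymmetric exclusion process started from the step configuration, $\xi(i,0)=i$ for $i\le 0$ and $\xi(i,0)=\infty$ for $i>0$, which obeys almost surely the following jump rule: at each epoch $\tau$ of $\mathcal D_i^k$, $$\xi(i,\tau)=\min\{\xi(i,\tau-)+k,\ \xi(i+1,\tau-)-1\},$$ and particle $i$ does not move between the epochs of $\bigcup_k\mathcal D_i^k$. Then there exists a finite, continuous, convex function $g$ on $(-\infty,0]$, depending only on the rates $(\beta_k)$, such that $$\lim_{n\to\infty} n^{-1}\xi([nx],nt)=t\,g(x/t)\quad\text{in probability, for each } x\le 0 \text{ and } t>0,$$ where $[y]$ denotes the largest integer $\le y$. (Almost surely, $\xi(i,t)$ is finite for all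 $i\le0$ and $t\ge0$.) -/

import Mathlib

open MeasureTheory ProbabilityTheory Filter Set
open scoped Topology NNReal ENNReal

noncomputable section

/-- The number of points of `S` in the time interval `[a, b)`. -/
def epochCount (S : Set ℝ) (a b : ℝ) : ℕ∞ := (S ∩ Ico a b).encard

/-- `D` is a homogeneous Poisson point process of rate `r` on `[0, ∞)`: a random set of epochs
such that the number of epochs in `[s, s + h)` is Poisson distributed with mean `r * h`, and the
numbers of epochs in successive disjoint intervals are independent. -/
structure IsPoissonPointProcess {Ω : Type*} [MeasurableSpace Ω] (P : Measure Ω)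
    (D : Ω → Set ℝ) (r : ℝ≥0) : Prop where
  subset_Ici : ∀ ω, D ω ⊆ Ici 0
  measurable_count : ∀ a b : ℝ, Measurable fun ω => epochCount (D ω) a b
  hasLaw_count : ∀ s h : ℝ≥0, HasLaw (fun ω => epochCount (D ω) s (s + h))
    ((poissonMeasure (r * h)).map (fun n : ℕ => (n : ℕ∞))) P
  indep_count : ∀ t : ℕ → ℝ, 0 ≤ t 0 → Monotone t →
    iIndepFun (fun (n : ℕ) ω => epochCount (D ω) (t n) (t (n + 1))) P

/-- The σ-algebra generated by all the counts of the random set `D`. -/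
abbrev epochSigma {Ω : Type*} (D : Ω → Set ℝ) : MeasurableSpace Ω :=
  ⨆ (a : ℝ) (b : ℝ), MeasurableSpace.comap (fun ω => epochCount (D ω) a b) inferInstance

/-- The jump commands: `D i k` is the set of epochs at which particle `i` attempts a jump of
`k` steps. These are mutually independent homogeneous Poisson point processes, of rate `β k`. -/
structure IsJumpCommands {Ω : Type*} [MeasurableSpace Ω] (P : Measure Ω) (β : ℕ+ → ℝ≥0)
    (D : ℤ → ℕ+ → Ω → Set ℝ) : Prop where
  poisson : ∀ i k, IsPoissonPointProcess P (D i k) (β k)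
  indep : iIndep (fun p : ℤ × ℕ+ => epochSigma (D p.1 p.2)) P

/-- The evolution `σ` (`σ i t` is the location of particle `i` at time `t ≥ 0`, with `⊤` for a
particle that is permanently at `+∞`) obeys the jump rule for the realization `D` of the jump
commands. In the first field `a = σ(i, τ-)` and `b = σ(i + 1, τ-)`. -/
structure ObeysJumpRule (D : ℤ → ℕ+ → Set ℝ) (σ : ℤ → ℝ → WithTop ℤ) : Prop where
  jump : ∀ (i : ℤ) (k : ℕ+) (τ : ℝ), 0 < τ → τ ∈ D i k → ∃ a b : WithTop ℤ,
    (∀ᶠ u in 𝓝[<] τ, σ i u = a) ∧ (∀ᶠ u in 𝓝[<] τ, σ (i + 1) u = b) ∧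
      σ i τ = min (a + ((k : ℤ) : WithTop ℤ)) (b - 1)
  const : ∀ (i : ℤ) (s t : ℝ), 0 ≤ s → s ≤ t → (∀ k, Disjoint (D i k) (Ioc s t)) →
    σ i t = σ i s

/-- The step configuration: sites `≤ 0` are occupied and there is no particle to the right. -/
def stepConfig (i : ℤ) : WithTop ℤ := if 0 < i then ⊤ else (i : WithTop ℤ)

/-- `ξ` is the exclusion process started from the step configuration and driven by the jump
commands `D`. -/
def IsStepProcess {Ω : Type*} [MeasurableSpace Ω] (P : Measure Ω) (D : ℤ → ℕ+ → Ω → Set ℝ)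
    (ξ : ℤ → ℝ → Ω → WithTop ℤ) : Prop :=
  ∀ᵐ ω ∂P, ObeysJumpRule (fun i k => D i k ω) (fun i t => ξ i t ω) ∧
    ∀ i, ξ i 0 ω = stepConfig i

/-- The location of a particle as a real number, for a particle that is not at infinity. -/
def location (z : WithTop ℤ) : ℝ := ((z.untopD 0 : ℤ) : ℝ)

end

/-!
The displacement of particle `-m` at time `t` is `ξ (-m) t + m`. The jump rule is linear in the
min-plus sense and monotone, so restarting the process at time `s` from the step configuration
whose leader is the particle `-m`, placed where that particle is, can only move the particles behind
it to the right: the displacement is subadditive in `(m, t)`, with increments governed by the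
commands in disjoint space-time regions. The mean displacement per unit time therefore has a limit
along the rays `m = y t`, which is an infimum (`asympDisp`), and subadditivity in both variables
makes it convex in `y`. The limit shape is `g x = x + asympDisp (-x)`.

All of this is carried out for discrete-time dynamics (`disp`) in which the time axis is cut into
cells of length `2⁻ᴺ` and each particle attempts, in each cell, the largest jump of at most `N`
steps commanded in that cell. The attempts are i.i.d. with a law depending only on the
rates (`IsJumpCommands.measurePreserving_cellJump`), so that the means and `asympDisp` do not refer
to any probability space. Refining the mesh increases the displacements
(`disp_cellJump_le_succ`), and almost surely the discrete dynamics with a small mesh reproduces the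
process exactly (`ObeysJumpRule.eventually_eq_disp_ceil`): the particles that start at infinity stay
there because, in a short time interval, there are resting particles arbitrarily far to the right,
and the epochs of the other particles are locally finite, hence separated by a small mesh.

For the convergence in probability, a displacement is bounded by a sum of i.i.d. block
displacements whose variances are bounded uniformly in `N` through `∑ k² β_k`. Hence the excess
over the limit shape is negligible in mean (`eventually_integral_disp_sub_pos_le`), which gives the
upper bound; since the mean itself is never below the limit shape, the lower bound follows.
Continuity of `g` away from `0` comes from convexity. At `0` it comes from an exponential moment
bound (`le_meanDisp`): the `m` particles ahead cost at most a constant times `m`, so that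
`asympDisp y` is at least `∑ k β_k - δ - C y` (`exists_le_asympDisp`).
-/

noncomputable section

/-! ### The discrete-time exclusion dynamics -/

/-- Discrete-time exclusion started from the step configuration, in which particle `-m` attempts
a jump of `g (m, l)` steps in the time step from `l` to `l + 1`, and all the particles are
updated in parallel: `disp g m l` is the displacement of particle `-m` after `l` time steps.
Particle `-m` is at `disp g m l - m`, so the exclusion constraint reads
`disp g (m + 1) (l + 1) ≤ disp g m l`. -/
def disp (g : ℕ × ℕ → ℕ) : ℕ → ℕ → ℕ
  | _, 0 => 0
  | 0, l + 1 => disp g 0 l + g (0, l)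
  | m + 1, l + 1 => min (disp g (m + 1) l + g (m + 1, l)) (disp g m l)

@[simp] lemma disp_zero_right (g : ℕ × ℕ → ℕ) (m : ℕ) : disp g m 0 = 0 := by
  cases m <;> simp [disp]

lemma disp_zero_succ (g : ℕ × ℕ → ℕ) (l : ℕ) : disp g 0 (l + 1) = disp g 0 l + g (0, l) := by
  simp [disp]

lemma disp_succ_succ (g : ℕ × ℕ → ℕ) (m l : ℕ) :
    disp g (m + 1) (l + 1) = min (disp g (m + 1) l + g (m + 1, l)) (disp g m l) := by
  simp [disp]

lemma disp_succ_le (g : ℕ × ℕ → ℕ) (m l : ℕ) : disp g m (l + 1) ≤ disp g m l + g (m, l) := by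
  cases m with
  | zero => rw [disp_zero_succ]
  | succ m => rw [disp_succ_succ]; exact min_le_left _ _

lemma disp_antitone_and_monotone (g : ℕ × ℕ → ℕ) (l : ℕ) :
    (∀ m, disp g (m + 1) l ≤ disp g m l) ∧ ∀ m, disp g m l ≤ disp g m (l + 1) := by
  have key : ∀ l, (∀ m, disp g (m + 1) l ≤ disp g m l) → ∀ m, disp g m l ≤ disp g m (l + 1) := by
    intro l h m
    cases m with
    | zero => rw [disp_zero_succ]; omega
    | succ m => rw [disp_succ_succ]; have := h m; omega
  have anti : ∀ m, disp g (m + 1) l ≤ disp g m l := by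
    induction l with
    | zero => simp
    | succ l ih =>
      intro m
      have := key l ih m
      rw [disp_succ_succ]
      omega
  exact ⟨anti, key l anti⟩

lemma disp_antitone_left (g : ℕ × ℕ → ℕ) (l : ℕ) : Antitone fun m => disp g m l :=
  antitone_nat_of_succ_le (disp_antitone_and_monotone g l).1

lemma disp_mono_right (g : ℕ × ℕ → ℕ) (m : ℕ) : Monotone (disp g m) :=
  monotone_nat_of_le_succ fun l => (disp_antitone_and_monotone g l).2 m

lemma disp_zero_left (g : ℕ × ℕ → ℕ) (l : ℕ) :
    disp g 0 l = ∑ j ∈ Finset.range l, g (0, j) := by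
  induction l with
  | zero => simp
  | succ l ih => rw [disp_zero_succ, Finset.sum_range_succ, ih]

lemma disp_le_sum (g : ℕ × ℕ → ℕ) (m l : ℕ) :
    disp g m l ≤ ∑ j ∈ Finset.range l, g (0, j) :=
  (disp_antitone_left g l (Nat.zero_le m)).trans (disp_zero_left g l).le

/-- The jump attempts seen from particle `-a` at time `b`. -/
def shiftField (a b : ℕ) (g : ℕ × ℕ → ℕ) : ℕ × ℕ → ℕ := fun p => g (a + p.1, b + p.2)

/-- Restarting the dynamics from the step configuration whose leader is the particle `-m` at
time `s` can only move the particles to the right; this is the subadditivity that drives the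
whole proof. -/
lemma disp_add_le (g : ℕ × ℕ → ℕ) (m m' s t : ℕ) :
    disp g (m + m') (s + t) ≤ disp g m s + disp (shiftField m s g) m' t := by
  induction t generalizing m' with
  | zero => simpa using disp_antitone_left g s (Nat.le_add_right m m')
  | succ t ih =>
    cases m' with
    | zero =>
      have h1 := disp_succ_le g m (s + t)
      have h2 := ih 0
      rw [disp_zero_succ]
      simp only [shiftField, add_zero] at h2 ⊢
      rw [← add_assoc s t 1]
      omega
    | succ m' =>
      have h1 := ih (m' + 1)
      have h2 := ih m'
      rw [disp_succ_succ, ← add_assoc s t 1, ← add_assoc m m' 1, disp_succ_succ]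
      rw [← add_assoc m m' 1] at h1
      simp only [shiftField] at h1 h2 ⊢
      rw [← add_assoc m m' 1]
      omega

lemma disp_mul_le (g : ℕ × ℕ → ℕ) (m s q : ℕ) :
    disp g (q * m) (q * s)
      ≤ ∑ j ∈ Finset.range q, disp (shiftField (j * m) (j * s) g) m s := by
  induction q with
  | zero => simp
  | succ q ih =>
    rw [Finset.sum_range_succ, Nat.succ_mul, Nat.succ_mul]
    exact (disp_add_le g _ _ _ _).trans (Nat.add_le_add_right ih _)

/-- Halving the time step moves the particles to the right, if an attempt of the coarse dynamics
is at most the larger of the two corresponding attempts of the fine dynamics. -/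
lemma disp_le_disp_two_mul {g g' : ℕ × ℕ → ℕ}
    (h : ∀ i l, g (i, l) ≤ max (g' (i, 2 * l)) (g' (i, 2 * l + 1))) (m l : ℕ) :
    disp g m l ≤ disp g' m (2 * l) := by
  induction l generalizing m with
  | zero => simp
  | succ l ih =>
    rw [Nat.mul_succ]
    cases m with
    | zero =>
      have h1 := h 0 l
      have h2 := ih 0
      rw [disp_zero_succ, disp_zero_succ, disp_zero_succ]
      omega
    | succ m =>
      have h1 := h (m + 1) l
      have h2 := ih (m + 1)
      have h3 := ih m
      have h4 := disp_mono_right g' m (Nat.le_succ (2 * l))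
      rw [disp_succ_succ, disp_succ_succ, disp_succ_succ]
      simp only [Nat.succ_eq_add_one] at h4
      omega

lemma measurable_disp {Ω : Type*} {mΩ : MeasurableSpace Ω} {G : Ω → ℕ × ℕ → ℕ} (m l : ℕ)
    (hG : ∀ i, ∀ j < l, Measurable fun ω => G ω (i, j)) :
    Measurable fun ω => disp (G ω) m l := by
  induction l generalizing m with
  | zero => simp
  | succ l ih =>
    have ih' := fun m => ih m fun i j hj => hG i j (hj.trans l.lt_succ_self)
    cases m with
    | zero =>
      simp only [disp_zero_succ]
      exact (ih' 0).add (hG _ _ l.lt_succ_self)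
    | succ m =>
      simp only [disp_succ_succ]
      exact ((ih' _).add (hG _ _ l.lt_succ_self)).min (ih' m)

/-! ### Independent identically distributed attempts -/

/-- The law of a field of independent attempts with common law `ν`. -/
abbrev fieldLaw (ν : Measure ℕ) : Measure (ℕ × ℕ → ℕ) := Measure.infinitePi fun _ => ν

/-- The mean displacement of particle `-m` after `l` steps, for attempts of law `ν`. -/
def meanDisp (ν : Measure ℕ) (m l : ℕ) : ℝ := ∫ g, (disp g m l : ℝ) ∂fieldLaw ν

lemma meanDisp_nonneg (ν : Measure ℕ) (m l : ℕ) : 0 ≤ meanDisp ν m l :=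
  integral_nonneg fun _ => Nat.cast_nonneg _

section Field

variable {ν : Measure ℕ} [IsProbabilityMeasure ν]

lemma measurable_disp_field (m l : ℕ) : Measurable fun g : ℕ × ℕ → ℕ => disp g m l :=
  measurable_disp m l fun _ _ _ => measurable_pi_apply _

lemma measurable_shiftField (a b : ℕ) : Measurable (shiftField a b) :=
  measurable_pi_lambda _ fun _ => measurable_pi_apply _

lemma measurePreserving_shiftField (a b : ℕ) :
    MeasurePreserving (shiftField a b) (fieldLaw ν) (fieldLaw ν) := by
  refine ⟨measurable_shiftField a b, ?_⟩
  exact Measure.map_infinitePi_infinitePi_of_inj (P := fun _ : ℕ × ℕ => ν)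
    (f := fun p : ℕ × ℕ => (a + p.1, b + p.2)) (by rintro ⟨i, j⟩ ⟨i', j'⟩ h; simpa using h)

lemma measurePreserving_eval_field (p : ℕ × ℕ) :
    MeasurePreserving (fun g : ℕ × ℕ → ℕ => g p) (fieldLaw ν) ν :=
  measurePreserving_eval_infinitePi (fun _ : ℕ × ℕ => ν) p

lemma iIndepFun_field : iIndepFun (fun (p : ℕ × ℕ) (g : ℕ × ℕ → ℕ) => g p) (fieldLaw ν) :=
  iIndepFun_infinitePi (P := fun _ : ℕ × ℕ => ν) (X := fun _ n => n) fun _ => measurable_id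

/-- The σ-algebra of the attempts in the time steps `s ≤ l < t`. -/
abbrev stripSigma (s t : ℕ) : MeasurableSpace (ℕ × ℕ → ℕ) :=
  ⨆ p ∈ {p : ℕ × ℕ | s ≤ p.2 ∧ p.2 < t}, MeasurableSpace.comap (fun g : ℕ × ℕ → ℕ => g p) ⊤

lemma indep_stripSigma {s t s' t' : ℕ} (h : t ≤ s') :
    Indep (stripSigma s t) (stripSigma s' t') (fieldLaw ν) := by
  refine indep_iSup_of_disjoint (m := fun p : ℕ × ℕ =>
    MeasurableSpace.comap (fun g : ℕ × ℕ → ℕ => g p) ⊤) (fun p => ?_) ?_ ?_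
  · exact (measurable_pi_apply p).comap_le
  · exact iIndepFun_field (ν := ν)
  · rw [Set.disjoint_left]
    rintro p ⟨_, h1⟩ ⟨h2, _⟩
    omega

lemma measurable_disp_stripSigma (a b m l : ℕ) :
    Measurable[stripSigma b (b + l)] fun g : ℕ × ℕ → ℕ => disp (shiftField a b g) m l := by
  refine measurable_disp (mΩ := stripSigma b (b + l)) m l fun i j hj => ?_
  have h : MeasurableSpace.comap (fun g : ℕ × ℕ → ℕ => g (a + i, b + j)) ⊤
      ≤ stripSigma b (b + l) :=
    le_iSup₂_of_le (f := fun (p : ℕ × ℕ) (_ : p ∈ {p : ℕ × ℕ | b ≤ p.2 ∧ p.2 < b + l}) =>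
      MeasurableSpace.comap (fun g : ℕ × ℕ → ℕ => g p) ⊤) (a + i, b + j)
      (by simp only [Set.mem_ofPred_eq]; omega) le_rfl
  exact (measurable_iff_comap_le.2 le_rfl : Measurable[MeasurableSpace.comap
    (fun g : ℕ × ℕ → ℕ => g (a + i, b + j)) ⊤] fun g : ℕ × ℕ → ℕ => g (a + i, b + j)).mono h le_rfl

lemma memLp_eval_field (hν : MemLp (fun n : ℕ => (n : ℝ)) 2 ν) (p : ℕ × ℕ) :
    MemLp (fun g : ℕ × ℕ → ℕ => (g p : ℝ)) 2 (fieldLaw ν) :=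
  hν.comp_measurePreserving (measurePreserving_eval_field p)

lemma memLp_sum_field (hν : MemLp (fun n : ℕ => (n : ℝ)) 2 ν) (l : ℕ) :
    MemLp (fun g : ℕ × ℕ → ℕ => ∑ j ∈ Finset.range l, (g (0, j) : ℝ)) 2 (fieldLaw ν) :=
  memLp_finsetSum _ fun j _ => memLp_eval_field hν (0, j)

lemma disp_le_sum_real (g : ℕ × ℕ → ℕ) (m l : ℕ) :
    (disp g m l : ℝ) ≤ ∑ j ∈ Finset.range l, (g (0, j) : ℝ) := by
  exact_mod_cast disp_le_sum g m l

lemma memLp_disp (hν : MemLp (fun n : ℕ => (n : ℝ)) 2 ν) (m l : ℕ) :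
    MemLp (fun g : ℕ × ℕ → ℕ => (disp g m l : ℝ)) 2 (fieldLaw ν) := by
  refine (memLp_sum_field hν l).mono
    ((measurable_of_countable _).comp (measurable_disp_field m l)).aestronglyMeasurable
    (ae_of_all _ fun g => ?_)
  rw [Real.norm_of_nonneg (Nat.cast_nonneg _),
    Real.norm_of_nonneg (Finset.sum_nonneg fun _ _ => Nat.cast_nonneg _)]
  exact disp_le_sum_real g m l

lemma integrable_disp (hν : MemLp (fun n : ℕ => (n : ℝ)) 2 ν) (m l : ℕ) :
    Integrable (fun g : ℕ × ℕ → ℕ => (disp g m l : ℝ)) (fieldLaw ν) :=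
  (memLp_disp hν m l).integrable (by norm_num)

lemma memLp_disp_shift (hν : MemLp (fun n : ℕ => (n : ℝ)) 2 ν) (a b m l : ℕ) :
    MemLp (fun g : ℕ × ℕ → ℕ => (disp (shiftField a b g) m l : ℝ)) 2 (fieldLaw ν) :=
  (memLp_disp hν m l).comp_measurePreserving (measurePreserving_shiftField a b)

lemma integral_shift (a b : ℕ) (F : (ℕ × ℕ → ℕ) → ℝ)
    (hF : AEStronglyMeasurable F (fieldLaw ν)) :
    ∫ g, F (shiftField a b g) ∂fieldLaw ν = ∫ g, F g ∂fieldLaw ν := by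
  have h := measurePreserving_shiftField (ν := ν) a b
  conv_rhs => rw [← h.map_eq]
  rw [integral_map h.measurable.aemeasurable (by rwa [h.map_eq])]

lemma integral_eval_field (p : ℕ × ℕ) (F : ℕ → ℝ) :
    ∫ g, F (g p) ∂fieldLaw ν = ∫ n, F n ∂ν := by
  have h := measurePreserving_eval_field (ν := ν) p
  conv_rhs => rw [← h.map_eq]
  rw [integral_map h.measurable.aemeasurable
    (measurable_of_countable F).aestronglyMeasurable]

lemma meanDisp_antitone (hν : MemLp (fun n : ℕ => (n : ℝ)) 2 ν) (l : ℕ) :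
    Antitone fun m => meanDisp ν m l := fun _ _ h =>
  integral_mono (integrable_disp hν _ _) (integrable_disp hν _ _) fun g =>
    Nat.cast_le.2 (disp_antitone_left g l h)

lemma meanDisp_add_le (hν : MemLp (fun n : ℕ => (n : ℝ)) 2 ν) (m m' s t : ℕ) :
    meanDisp ν (m + m') (s + t) ≤ meanDisp ν m s + meanDisp ν m' t := by
  have h := integral_shift (ν := ν) m s (fun g => (disp g m' t : ℝ))
    (memLp_disp hν m' t).aestronglyMeasurable
  rw [meanDisp, meanDisp, meanDisp, ← h, ← integral_add (integrable_disp hν _ _)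
    ((memLp_disp_shift hν _ _ _ _).integrable (by norm_num))]
  refine integral_mono (integrable_disp hν _ _) ((integrable_disp hν _ _).add
    ((memLp_disp_shift hν _ _ _ _).integrable (by norm_num))) fun g => ?_
  have h := disp_add_le g m m' s t
  show (disp g (m + m') (s + t) : ℝ) ≤ disp g m s + disp (shiftField m s g) m' t
  exact_mod_cast h

lemma integral_sum_field (hν : MemLp (fun n : ℕ => (n : ℝ)) 2 ν) (l : ℕ) :
    ∫ g : ℕ × ℕ → ℕ, ∑ j ∈ Finset.range l, (g (0, j) : ℝ) ∂fieldLaw ν = l * ∫ n, (n : ℝ) ∂ν := by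
  rw [integral_finsetSum _ fun j _ => (memLp_eval_field hν (0, j)).integrable (by norm_num)]
  simp [integral_eval_field _ fun n : ℕ => (n : ℝ)]

lemma meanDisp_le (hν : MemLp (fun n : ℕ => (n : ℝ)) 2 ν) (m l : ℕ) :
    meanDisp ν m l ≤ l * ∫ n, (n : ℝ) ∂ν := by
  rw [← integral_sum_field hν]
  exact integral_mono (integrable_disp hν _ _) ((memLp_sum_field hν l).integrable (by norm_num))
    fun g => disp_le_sum_real g m l

lemma integral_disp_sq_le (hν : MemLp (fun n : ℕ => (n : ℝ)) 2 ν) (m l : ℕ) :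
    ∫ g, (disp g m l : ℝ) ^ 2 ∂fieldLaw ν
      ≤ l * ∫ n, (n : ℝ) ^ 2 ∂ν + (l * ∫ n, (n : ℝ) ∂ν) ^ 2 := by
  set S : (ℕ × ℕ → ℕ) → ℝ := fun g => ∑ j ∈ Finset.range l, (g (0, j) : ℝ) with hS
  have h1 : ∫ g, (disp g m l : ℝ) ^ 2 ∂fieldLaw ν ≤ ∫ g, S g ^ 2 ∂fieldLaw ν :=
    integral_mono (memLp_disp hν m l).integrable_sq (memLp_sum_field hν l).integrable_sq
      fun g => pow_le_pow_left₀ (Nat.cast_nonneg _) (disp_le_sum_real g m l) 2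
  have h2 : Var[S; fieldLaw ν] ≤ l * ∫ n, (n : ℝ) ^ 2 ∂ν := by
    have : S = ∑ j ∈ Finset.range l, fun g : ℕ × ℕ → ℕ => (g (0, j) : ℝ) := by
      ext g; simp [hS]
    rw [this, IndepFun.variance_sum (fun j _ => memLp_eval_field hν (0, j))]
    · calc ∑ j ∈ Finset.range l, Var[fun g : ℕ × ℕ → ℕ => (g (0, j) : ℝ); fieldLaw ν]
          ≤ ∑ j ∈ Finset.range l, ∫ n, (n : ℝ) ^ 2 ∂ν := Finset.sum_le_sum fun j _ => by
            refine (variance_le_expectation_sq (μ := fieldLaw ν)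
              (memLp_eval_field hν (0, j)).aestronglyMeasurable).trans (le_of_eq ?_)
            exact integral_eval_field (ν := ν) (0, j) fun n : ℕ => (n : ℝ) ^ 2
        _ = _ := by simp
    · intro i _ j _ hij
      exact ((iIndepFun_field (ν := ν)).indepFun (i := (0, i)) (j := (0, j))
        (by simpa using hij)).comp (measurable_of_countable (fun n : ℕ => (n : ℝ)))
        (measurable_of_countable (fun n : ℕ => (n : ℝ)))
  have h3 := variance_eq_sub (memLp_sum_field hν l)
  have h4 := integral_sum_field hν l
  rw [h4] at h3
  simp only [Pi.pow_apply] at h3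
  linarith

end Field

lemma integral_abs_le_sqrt {Ω : Type*} {mΩ : MeasurableSpace Ω} {P : Measure Ω}
    [IsProbabilityMeasure P] {X : Ω → ℝ} (hX : MemLp X 2 P) :
    ∫ ω, |X ω| ∂P ≤ √(∫ ω, X ω ^ 2 ∂P) := by
  have h := variance_nonneg (fun ω => |X ω|) P
  rw [variance_eq_sub (show MemLp (fun ω => |X ω|) 2 P from hX.abs)] at h
  refine Real.le_sqrt_of_sq_le ?_
  simpa [sub_nonneg] using h

/-- Concentration along a ray: up to an error of order `√q`, uniform in the law `ν` once its first
two moments are controlled, `q` blocks move a particle by at most `q` times the mean of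
a block. -/
lemma integral_disp_sub_pos_le {ν : Measure ℕ} [IsProbabilityMeasure ν]
    (hν : MemLp (fun n : ℕ => (n : ℝ)) 2 ν) (m L q : ℕ) {V c : ℝ}
    (hV : ∫ g, (disp g m L : ℝ) ^ 2 ∂fieldLaw ν ≤ V) :
    ∫ g, max ((disp g (q * m) ((q + 1) * L) : ℝ) - c) 0 ∂fieldLaw ν
      ≤ √(q * V) + max (q * meanDisp ν m L - c) 0 + meanDisp ν 0 L := by
  set Y : ℕ → (ℕ × ℕ → ℕ) → ℝ := fun j g => (disp (shiftField (j * m) (j * L) g) m L : ℝ)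
  set Z : (ℕ × ℕ → ℕ) → ℝ := fun g => (disp (shiftField (q * m) (q * L) g) 0 L : ℝ)
  set T : (ℕ × ℕ → ℕ) → ℝ := ∑ j ∈ Finset.range q, Y j with hT
  have hY : ∀ j, MemLp (Y j) 2 (fieldLaw ν) := fun j => memLp_disp_shift hν _ _ _ _
  have hZ : MemLp Z 2 (fieldLaw ν) := memLp_disp_shift hν _ _ _ _
  have hTm : MemLp T 2 (fieldLaw ν) := memLp_finsetSum' _ fun j _ => hY j
  have hYmean : ∀ j, ∫ g, Y j g ∂fieldLaw ν = meanDisp ν m L := fun j =>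
    integral_shift (ν := ν) (j * m) (j * L) (fun g => (disp g m L : ℝ))
      (memLp_disp hν m L).aestronglyMeasurable
  have hZmean : ∫ g, Z g ∂fieldLaw ν = meanDisp ν 0 L :=
    integral_shift (ν := ν) (q * m) (q * L) (fun g => (disp g 0 L : ℝ))
      (memLp_disp hν 0 L).aestronglyMeasurable
  have hTmean : ∫ g, T g ∂fieldLaw ν = q * meanDisp ν m L := by
    simp only [hT, Finset.sum_apply]
    rw [integral_finsetSum _ fun j _ => (hY j).integrable (by norm_num)]
    simp [hYmean]
  have hTvar : Var[T; fieldLaw ν] ≤ q * V := by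
    rw [hT, IndepFun.variance_sum fun j _ => hY j]
    · calc ∑ j ∈ Finset.range q, Var[Y j; fieldLaw ν]
          ≤ ∑ j ∈ Finset.range q, V := Finset.sum_le_sum fun j _ => by
            refine (variance_le_expectation_sq (hY j).aestronglyMeasurable).trans
              (le_trans (le_of_eq ?_) hV)
            exact integral_shift (ν := ν) (j * m) (j * L) (fun g => (disp g m L : ℝ) ^ 2)
              ((memLp_disp hν m L).aestronglyMeasurable.pow 2)
        _ = _ := by simp
    · have hlt : ∀ i j, i < j → IndepFun (Y i) (Y j) (fieldLaw ν) := by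
        intro i j hij
        have h1 : i * L + L ≤ j * L := by
          rw [← Nat.succ_mul]; exact Nat.mul_le_mul_right L hij
        have h2 := indep_stripSigma (ν := ν) (s := i * L) (t' := j * L + L) h1
        refine indep_of_indep_of_le_left (indep_of_indep_of_le_right h2 ?_) ?_
        · exact ((measurable_of_countable (fun n : ℕ => (n : ℝ))).comp
            (measurable_disp_stripSigma (j * m) (j * L) m L)).comap_le
        · exact ((measurable_of_countable (fun n : ℕ => (n : ℝ))).comp
            (measurable_disp_stripSigma (i * m) (i * L) m L)).comap_le
      intro i _ j _ hij
      rcases lt_or_gt_of_ne hij with h | h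
      · exact hlt i j h
      · exact (hlt j i h).symm
  have hdom : ∀ g, (disp g (q * m) ((q + 1) * L) : ℝ) ≤ T g + Z g := by
    intro g
    have h1 := disp_add_le g (q * m) 0 (q * L) L
    have h2 := disp_mul_le g m L q
    have h3 : disp g (q * m) ((q + 1) * L) ≤
        ∑ j ∈ Finset.range q, disp (shiftField (j * m) (j * L) g) m L
          + disp (shiftField (q * m) (q * L) g) 0 L := by
      rw [Nat.succ_mul]
      exact h1.trans (Nat.add_le_add_right h2 _)
    simp only [hT, Finset.sum_apply, Y, Z]
    exact_mod_cast h3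
  set M : ℝ := q * meanDisp ν m L
  have hTM : MemLp (fun g => T g - M) 2 (fieldLaw ν) := hTm.sub (memLp_const M)
  have hL1 : ∫ g, |T g - M| ∂fieldLaw ν ≤ √(q * V) := by
    refine (integral_abs_le_sqrt hTM).trans (Real.sqrt_le_sqrt ?_)
    rw [variance_eq_integral hTm.aestronglyMeasurable.aemeasurable, hTmean] at hTvar
    exact hTvar
  have hi1 : Integrable (fun g => |T g - M|) (fieldLaw ν) :=
    (hTM.integrable (by norm_num)).abs
  have hi2 : Integrable Z (fieldLaw ν) := hZ.integrable (by norm_num)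
  have hi3 : Integrable (fun g => |T g - M| + max (M - c) 0) (fieldLaw ν) :=
    hi1.add (integrable_const _)
  calc ∫ g, max ((disp g (q * m) ((q + 1) * L) : ℝ) - c) 0 ∂fieldLaw ν
      ≤ ∫ g, (|T g - M| + max (M - c) 0 + Z g) ∂fieldLaw ν := by
        refine integral_mono (((integrable_disp hν _ _).sub (integrable_const c)).pos_part)
          (hi3.add hi2) fun g => ?_
        have h0 : 0 ≤ Z g := Nat.cast_nonneg _
        have := hdom g
        have h4 := le_abs_self (T g - M)
        have h5 := abs_nonneg (T g - M)
        have h6 := le_max_left (M - c) 0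
        have h7 := le_max_right (M - c) 0
        refine max_le ?_ ?_ <;> linarith
    _ = ∫ g, |T g - M| ∂fieldLaw ν + max (M - c) 0 + meanDisp ν 0 L := by
        rw [integral_add hi3 hi2, integral_add hi1 (integrable_const _), hZmean]
        simp
    _ ≤ _ := by linarith

/-! ### An exponential lower bound for the mean displacement -/

section Exponential

variable {ν : Measure ℕ} [IsProbabilityMeasure ν] {θ : ℝ}

lemma integrable_exp_neg {Ω : Type*} {mΩ : MeasurableSpace Ω} {P : Measure Ω}
    [IsFiniteMeasure P] {X : Ω → ℕ} (hX : Measurable X) (hθ : 0 ≤ θ) :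
    Integrable (fun ω => Real.exp (-θ * X ω)) P := by
  refine Integrable.of_bound ((measurable_of_countable
    (fun n : ℕ => Real.exp (-θ * n))).comp hX).aestronglyMeasurable 1 (ae_of_all _ fun ω => ?_)
  rw [Real.norm_of_nonneg (Real.exp_pos _).le, Real.exp_le_one_iff]
  nlinarith [(Nat.cast_nonneg (X ω) : (0 : ℝ) ≤ X ω)]

lemma integral_exp_disp_add (m l : ℕ) :
    ∫ g, Real.exp (-θ * (disp g m l + g (m, l) : ℕ)) ∂fieldLaw ν
      = (∫ g, Real.exp (-θ * disp g m l) ∂fieldLaw ν) * ∫ n : ℕ, Real.exp (-θ * n) ∂ν := by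
  have hind : IndepFun (fun g : ℕ × ℕ → ℕ => disp g m l) (fun g => g (m, l)) (fieldLaw ν) := by
    have h := indep_stripSigma (ν := ν) (s := 0) (t := l) (s' := l) (t' := l + 1) le_rfl
    refine indep_of_indep_of_le_left (indep_of_indep_of_le_right h ?_) ?_
    · exact le_iSup₂_of_le (f := fun (p : ℕ × ℕ) (_ : p ∈ {p : ℕ × ℕ | l ≤ p.2 ∧ p.2 < l + 1}) =>
        MeasurableSpace.comap (fun g : ℕ × ℕ → ℕ => g p) ⊤) (m, l)
        (by simp) le_rfl
    · have h := measurable_disp_stripSigma 0 0 m l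
      have h0 : ∀ g, shiftField 0 0 g = g := fun g => by ext p; simp [shiftField]
      simp only [h0] at h
      rw [zero_add] at h
      exact h.comap_le
  have h := (hind.comp (measurable_of_countable fun n : ℕ => Real.exp (-θ * n))
    (measurable_of_countable fun n : ℕ => Real.exp (-θ * n))).integral_fun_mul_eq_mul_integral
    ((measurable_of_countable (fun n : ℕ => Real.exp (-θ * n))).comp
      (measurable_disp_field m l)).aestronglyMeasurable
    ((measurable_of_countable (fun n : ℕ => Real.exp (-θ * n))).comp
      (measurable_pi_apply (m, l))).aestronglyMeasurable
  simp only [Function.comp_apply] at h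
  rw [integral_eval_field (m, l) fun n : ℕ => Real.exp (-θ * n)] at h
  rw [← h]
  congr with g
  rw [← Real.exp_add]
  push_cast
  ring_nf

lemma integral_exp_disp_le (hθ : 0 ≤ θ) {A : ℝ} (hA : 1 ≤ A) (m l : ℕ) :
    ∫ g, Real.exp (-θ * disp g m l) ∂fieldLaw ν
      ≤ A ^ m * (∫ n : ℕ, Real.exp (-θ * n) ∂ν + A⁻¹) ^ l := by
  set ρ := ∫ n : ℕ, Real.exp (-θ * n) ∂ν
  have hA0 : 0 < A := by linarith
  have hρ : 0 ≤ ρ := integral_nonneg fun _ => (Real.exp_pos _).le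
  have hr : 0 ≤ ρ + A⁻¹ := by positivity
  induction l generalizing m with
  | zero => simpa using one_le_pow₀ hA
  | succ l ih =>
    cases m with
    | zero =>
      simp only [disp_zero_succ]
      rw [integral_exp_disp_add, pow_succ, ← mul_assoc]
      refine mul_le_mul (ih 0) ?_ hρ (by positivity)
      linarith [inv_pos.2 hA0]
    | succ m =>
      have hi : Measurable fun g : ℕ × ℕ → ℕ => disp g (m + 1) l + g (m + 1, l) :=
        (measurable_disp_field _ _).add (measurable_pi_apply _)
      have h1 : ∫ g, Real.exp (-θ * disp g (m + 1) (l + 1)) ∂fieldLaw ν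
          ≤ ∫ g, (Real.exp (-θ * (disp g (m + 1) l + g (m + 1, l) : ℕ))
            + Real.exp (-θ * disp g m l)) ∂fieldLaw ν := by
        refine integral_mono (integrable_exp_neg (measurable_disp_field _ _) hθ)
          ((integrable_exp_neg hi hθ).add (integrable_exp_neg (measurable_disp_field _ _) hθ))
          fun g => ?_
        simp only [disp_succ_succ]
        rcases min_choice (disp g (m + 1) l + g (m + 1, l)) (disp g m l) with h | h <;> rw [h]
        · exact le_add_of_nonneg_right (Real.exp_pos _).le
        · exact le_add_of_nonneg_left (Real.exp_pos _).le
      rw [integral_add (integrable_exp_neg hi hθ)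
        (integrable_exp_neg (measurable_disp_field _ _) hθ), integral_exp_disp_add] at h1
      have h2 := mul_le_mul_of_nonneg_right (ih (m + 1)) hρ
      have h3 := ih m
      calc _ ≤ _ := h1
        _ ≤ A ^ (m + 1) * (ρ + A⁻¹) ^ l * ρ + A ^ m * (ρ + A⁻¹) ^ l := add_le_add h2 h3
        _ = A ^ (m + 1) * (ρ + A⁻¹) ^ (l + 1) := by
          rw [pow_succ, pow_succ]; field_simp

/-- The loss caused by the exclusion is linear in the number of particles ahead, with a constant
`log A / θ` that does not depend on the number of time steps. -/
lemma le_meanDisp (hν : MemLp (fun n : ℕ => (n : ℝ)) 2 ν) (hθ : 0 < θ) {A : ℝ} (hA : 1 ≤ A)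
    (m l : ℕ) :
    (l * (1 - ∫ n : ℕ, Real.exp (-θ * n) ∂ν - A⁻¹) - m * Real.log A) / θ ≤ meanDisp ν m l := by
  set ρ := ∫ n : ℕ, Real.exp (-θ * n) ∂ν
  set c := meanDisp ν m l with hc
  have hA0 : 0 < A := by linarith
  have hρ : 0 ≤ ρ := integral_nonneg fun _ => (Real.exp_pos _).le
  have hr : 0 < ρ + A⁻¹ := by positivity
  have hjensen : Real.exp (-θ * c) ≤ ∫ g, Real.exp (-θ * disp g m l) ∂fieldLaw ν := by
    have hi : Integrable (fun g : ℕ × ℕ → ℕ => -θ * (disp g m l : ℝ)) (fieldLaw ν) :=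
      (integrable_disp hν m l).const_mul _
    have hi' : Integrable (fun g : ℕ × ℕ → ℕ => 1 + θ * c + -θ * (disp g m l : ℝ)) (fieldLaw ν) :=
      (integrable_const _).add hi
    -- The exponential is bounded below by its tangent line at the mean.
    have h : ∫ g, Real.exp (-θ * c) * (1 + θ * c + -θ * disp g m l) ∂fieldLaw ν
        = Real.exp (-θ * c) := by
      rw [integral_const_mul, integral_add (integrable_const _) hi, integral_const_mul]
      simp only [integral_const, probReal_univ, one_smul]
      rw [← meanDisp, ← hc]
      ring
    calc Real.exp (-θ * c) = _ := h.symm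
      _ ≤ _ := by
        refine integral_mono (hi'.const_mul _)
          (integrable_exp_neg (measurable_disp_field _ _) hθ.le) fun g => ?_
        have h1 := Real.add_one_le_exp (θ * c + -θ * disp g m l)
        calc Real.exp (-θ * c) * (1 + θ * c + -θ * disp g m l)
            ≤ Real.exp (-θ * c) * Real.exp (θ * c + -θ * disp g m l) :=
              mul_le_mul_of_nonneg_left (by linarith) (Real.exp_pos _).le
          _ = _ := by rw [← Real.exp_add]; ring_nf
  have h1 := hjensen.trans (integral_exp_disp_le hθ.le hA m l)
  have h2 := Real.log_le_log (Real.exp_pos _) h1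
  rw [Real.log_exp, Real.log_mul (by positivity) (by positivity), Real.log_pow, Real.log_pow] at h2
  have h3 := Real.log_le_sub_one_of_pos hr
  have h4 := mul_le_mul_of_nonneg_left h3 (Nat.cast_nonneg l : (0 : ℝ) ≤ l)
  rw [div_le_iff₀ hθ]
  nlinarith

end Exponential

/-! ### The largest jump attempted in a time step -/

/-- The law of the number of points of a Poisson point process in a set of mean measure `r`. -/
def countLaw (r : ℝ≥0) : Measure ℕ∞ := (poissonMeasure r).map (fun n : ℕ => (n : ℕ∞))

instance (r : ℝ≥0) : IsProbabilityMeasure (countLaw r) :=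
  Measure.isProbabilityMeasure_map (measurable_of_countable _).aemeasurable

lemma countLaw_real_singleton_zero (r : ℝ≥0) : (countLaw r).real {0} = Real.exp (-r) := by
  rw [countLaw, map_measureReal_apply (measurable_of_countable _) (measurableSet_singleton _)]
  have : (fun n : ℕ => (n : ℕ∞)) ⁻¹' {0} = {0} := by ext n; simp
  rw [this, poissonMeasure_real_singleton]
  simp

/-- The largest `k ≤ N` such that at least one jump of `k` steps is attempted, when `c k` is the
number of attempts of `k` steps, and `0` if there is none. Jumps of more than `N` steps are
ignored. -/
def largestJump (N : ℕ) (c : ℕ+ → ℕ∞) : ℕ :=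
  (Finset.range N).sup fun k => if c k.succPNat = 0 then 0 else k + 1

lemma measurable_largestJump (N : ℕ) : Measurable (largestJump N) := by
  unfold largestJump
  induction N with
  | zero => simp
  | succ N ih =>
    simp only [Finset.range_add_one, Finset.sup_insert]
    exact (Measurable.ite (measurableSet_eq_fun (measurable_pi_apply _) measurable_const)
      measurable_const measurable_const).sup ih

lemma le_largestJump {N k : ℕ} {c : ℕ+ → ℕ∞} (hk : k < N) (hc : c k.succPNat ≠ 0) :
    k + 1 ≤ largestJump N c := by
  have h := Finset.le_sup (f := fun k => if c k.succPNat = 0 then 0 else k + 1)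
    (Finset.mem_range.2 hk)
  simp only [if_neg hc] at h
  exact h

lemma largestJump_eq_zero_or (N : ℕ) (c : ℕ+ → ℕ∞) :
    largestJump N c = 0 ∨ ∃ k < N, c k.succPNat ≠ 0 ∧ largestJump N c = k + 1 := by
  by_cases h0 : largestJump N c = 0
  · exact Or.inl h0
  · have hN : (Finset.range N).Nonempty := by
      by_contra h
      rw [Finset.not_nonempty_iff_eq_empty] at h
      simp [largestJump, h] at h0
    obtain ⟨k, hk, hk'⟩ := Finset.exists_mem_eq_sup _ hN
      fun k => if c k.succPNat = 0 then 0 else k + 1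
    rw [Finset.mem_range] at hk
    by_cases hc : c k.succPNat = 0
    · rw [if_pos hc] at hk'; exact absurd hk' h0
    · rw [if_neg hc] at hk'; exact Or.inr ⟨k, hk, hc, hk'⟩

lemma largestJump_le {N n : ℕ} {c : ℕ+ → ℕ∞} (h : ∀ k < N, c k.succPNat ≠ 0 → k + 1 ≤ n) :
    largestJump N c ≤ n := by
  rcases largestJump_eq_zero_or N c with h0 | ⟨k, hk, hc, h0⟩
  · omega
  · rw [h0]; exact h k hk hc

/-- The indicator that some jump of `k + 1` steps is attempted. -/
def attempted (c : ℕ+ → ℕ∞) (k : ℕ) : ℝ := if c k.succPNat = 0 then 0 else 1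

lemma attempted_nonneg (c : ℕ+ → ℕ∞) (k : ℕ) : 0 ≤ attempted c k := by
  unfold attempted; split_ifs <;> norm_num

lemma attempted_le_one (c : ℕ+ → ℕ∞) (k : ℕ) : attempted c k ≤ 1 := by
  unfold attempted; split_ifs <;> norm_num

lemma largestJump_pow_le (N p : ℕ) (hp : p ≠ 0) (c : ℕ+ → ℕ∞) :
    (largestJump N c : ℝ) ^ p ≤ ∑ k ∈ Finset.range N, ((k : ℝ) + 1) ^ p * attempted c k := by
  have hnn : ∀ k ∈ Finset.range N, 0 ≤ ((k : ℝ) + 1) ^ p * attempted c k := fun k _ =>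
    mul_nonneg (by positivity) (attempted_nonneg c k)
  rcases largestJump_eq_zero_or N c with h0 | ⟨k, hk, hc, h0⟩
  · rw [h0, Nat.cast_zero, zero_pow hp]
    exact Finset.sum_nonneg hnn
  · have := Finset.single_le_sum hnn (Finset.mem_range.2 hk)
    simpa [attempted, hc, h0] using this

lemma le_largestJump_sum {K N : ℕ} (hK : K ≤ N) (c : ℕ+ → ℕ∞) :
    ∑ k ∈ Finset.range K, ((k : ℝ) + 1) *
      (attempted c k - ∑ j ∈ (Finset.range K).erase k, attempted c k * attempted c j)
      ≤ largestJump N c := by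
  by_cases h : ∃ k < K, c k.succPNat ≠ 0
  · obtain ⟨k, hk, hc⟩ := h
    have hk1 : attempted c k = 1 := by simp [attempted, hc]
    rw [← Finset.add_sum_erase _ _ (Finset.mem_range.2 hk)]
    have h1 : ((k : ℝ) + 1) *
        (attempted c k - ∑ j ∈ (Finset.range K).erase k, attempted c k * attempted c j)
        ≤ largestJump N c := by
      have h2 : 0 ≤ ∑ j ∈ (Finset.range K).erase k, attempted c k * attempted c j :=
        Finset.sum_nonneg fun j _ => mul_nonneg (attempted_nonneg c k) (attempted_nonneg c j)
      have h3 : ((k : ℝ) + 1) ≤ largestJump N c := by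
        exact_mod_cast le_largestJump (hk.trans_le hK) hc
      rw [hk1] at h2 ⊢
      nlinarith [(Nat.cast_nonneg k : (0 : ℝ) ≤ k)]
    have h2 : ∑ i ∈ (Finset.range K).erase k, ((i : ℝ) + 1) *
        (attempted c i - ∑ j ∈ (Finset.range K).erase i, attempted c i * attempted c j) ≤ 0 := by
      refine Finset.sum_nonpos fun i hi => mul_nonpos_of_nonneg_of_nonpos (by positivity) ?_
      have hki : k ∈ (Finset.range K).erase i :=
        Finset.mem_erase.2 ⟨(Finset.ne_of_mem_erase hi).symm, Finset.mem_range.2 hk⟩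
      have := Finset.single_le_sum (f := fun j => attempted c i * attempted c j)
        (fun j _ => mul_nonneg (attempted_nonneg c i) (attempted_nonneg c j)) hki
      simp only [hk1, mul_one] at this
      linarith
    linarith
  · push Not at h
    have h0 : ∀ k ∈ Finset.range K, ((k : ℝ) + 1) *
        (attempted c k - ∑ j ∈ (Finset.range K).erase k, attempted c k * attempted c j) = 0 := by
      intro k hk
      simp [attempted, h k (Finset.mem_range.1 hk)]
    rw [Finset.sum_eq_zero h0]
    exact Nat.cast_nonneg _

/-- The law of the largest jump of at most `N` steps attempted in a time step, when the number of
attempts of `k` steps is Poisson distributed with mean `r k`, independently for the different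
`k`. -/
def jumpLaw (r : ℕ+ → ℝ≥0) (N : ℕ) : Measure ℕ :=
  (Measure.infinitePi fun k => countLaw (r k)).map (largestJump N)

instance (r : ℕ+ → ℝ≥0) (N : ℕ) : IsProbabilityMeasure (jumpLaw r N) :=
  Measure.isProbabilityMeasure_map (measurable_largestJump N).aemeasurable

section Moments

variable (r : ℕ+ → ℝ≥0)

lemma measurable_attempted (k : ℕ) : Measurable fun c => attempted c k :=
  Measurable.ite (measurableSet_eq_fun (measurable_pi_apply _) measurable_const)
    measurable_const measurable_const

lemma integrable_attempted (k : ℕ) :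
    Integrable (fun c => attempted c k) (Measure.infinitePi fun k => countLaw (r k)) :=
  Integrable.of_bound (measurable_attempted k).aestronglyMeasurable 1 (ae_of_all _ fun c => by
    rw [Real.norm_of_nonneg (attempted_nonneg c k)]; exact attempted_le_one c k)

lemma integrable_attempted_mul (j k : ℕ) :
    Integrable (fun c => attempted c j * attempted c k)
      (Measure.infinitePi fun k => countLaw (r k)) :=
  Integrable.of_bound ((measurable_attempted j).mul
    (measurable_attempted k)).aestronglyMeasurable 1 (ae_of_all _ fun c => by
    rw [Real.norm_of_nonneg (mul_nonneg (attempted_nonneg c j) (attempted_nonneg c k))]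
    exact mul_le_one₀ (attempted_le_one c j) (attempted_nonneg c k) (attempted_le_one c k))

lemma integral_attempted (k : ℕ) :
    ∫ c, attempted c k ∂(Measure.infinitePi fun k => countLaw (r k))
      = 1 - Real.exp (-r k.succPNat) := by
  have h := measurePreserving_eval_infinitePi (fun k => countLaw (r k)) k.succPNat
  have h1 : ∫ c, attempted c k ∂(Measure.infinitePi fun k => countLaw (r k))
      = ∫ n : ℕ∞, ({0}ᶜ : Set ℕ∞).indicator (fun _ => (1 : ℝ)) n ∂countLaw (r k.succPNat) := by
    rw [← h.map_eq, integral_map h.measurable.aemeasurable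
      (measurable_const.indicator (measurableSet_singleton _).compl).aestronglyMeasurable]
    congr with c
    by_cases hc : c k.succPNat = 0 <;> simp [attempted, hc]
  rw [h1, integral_indicator_const _ (measurableSet_singleton _).compl,
    probReal_compl_eq_one_sub (measurableSet_singleton _), countLaw_real_singleton_zero]
  simp

lemma integral_attempted_mul {j k : ℕ} (hjk : j ≠ k) :
    ∫ c, attempted c j * attempted c k ∂(Measure.infinitePi fun k => countLaw (r k))
      = (1 - Real.exp (-r j.succPNat)) * (1 - Real.exp (-r k.succPNat)) := by
  have hind := (iIndepFun_infinitePi (P := fun k => countLaw (r k)) (X := fun _ n => n)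
    fun _ => measurable_id).indepFun (i := j.succPNat) (j := k.succPNat)
    (fun h => hjk (Nat.succPNat_injective h))
  have hm : Measurable fun n : ℕ∞ => if n = 0 then (0 : ℝ) else 1 := measurable_of_countable _
  have h := (hind.comp hm hm).integral_fun_mul_eq_mul_integral
    (measurable_attempted j).aestronglyMeasurable (measurable_attempted k).aestronglyMeasurable
  rw [← integral_attempted r j, ← integral_attempted r k]
  exact h

lemma integral_jumpLaw (N : ℕ) (F : ℕ → ℝ) :
    ∫ n, F n ∂jumpLaw r N
      = ∫ c, F (largestJump N c) ∂(Measure.infinitePi fun k => countLaw (r k)) :=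
  integral_map (measurable_largestJump N).aemeasurable
    (measurable_of_countable F).aestronglyMeasurable

lemma largestJump_le_cap (N : ℕ) (c : ℕ+ → ℕ∞) : largestJump N c ≤ N :=
  largestJump_le fun _ hk _ => hk

lemma memLp_jumpLaw (N : ℕ) : MemLp (fun n : ℕ => (n : ℝ)) 2 (jumpLaw r N) := by
  refine MemLp.of_bound (measurable_of_countable _).aestronglyMeasurable N ?_
  rw [jumpLaw, ae_map_iff (measurable_largestJump N).aemeasurable (MeasurableSet.of_discrete)]
  refine ae_of_all _ fun c => ?_
  rw [Real.norm_of_nonneg (Nat.cast_nonneg _)]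
  exact_mod_cast largestJump_le_cap N c

lemma integrable_largestJump_pow (N p : ℕ) :
    Integrable (fun c => (largestJump N c : ℝ) ^ p)
      (Measure.infinitePi fun k => countLaw (r k)) := by
  refine Integrable.of_bound (((measurable_of_countable (fun n : ℕ => (n : ℝ) ^ p)).comp
    (measurable_largestJump N)).aestronglyMeasurable) ((N : ℝ) ^ p) (ae_of_all _ fun c => ?_)
  rw [Real.norm_of_nonneg (by positivity)]
  exact pow_le_pow_left₀ (Nat.cast_nonneg _) (by exact_mod_cast largestJump_le_cap N c) p

lemma integral_pow_jumpLaw_le (N p : ℕ) (hp : p ≠ 0) :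
    ∫ n, (n : ℝ) ^ p ∂jumpLaw r N
      ≤ ∑ k ∈ Finset.range N, ((k : ℝ) + 1) ^ p * r k.succPNat := by
  rw [integral_jumpLaw r N fun n => (n : ℝ) ^ p]
  have hi : ∀ k ∈ Finset.range N, Integrable (fun c => ((k : ℝ) + 1) ^ p * attempted c k)
      (Measure.infinitePi fun k => countLaw (r k)) := fun k _ =>
    (integrable_attempted r k).const_mul _
  refine (integral_mono (integrable_largestJump_pow r N p) (integrable_finsetSum _ hi)
    (largestJump_pow_le N p hp)).trans ?_
  rw [integral_finsetSum _ hi]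
  refine Finset.sum_le_sum fun k _ => ?_
  rw [integral_const_mul, integral_attempted]
  refine mul_le_mul_of_nonneg_left ?_ (by positivity)
  have := Real.add_one_le_exp (-(r k.succPNat : ℝ))
  linarith

lemma sub_sq_le_one_sub_exp_neg {x : ℝ} (hx : 0 ≤ x) : x - x ^ 2 ≤ 1 - Real.exp (-x) := by
  rcases le_total x 1 with h | h
  · have h1 := Real.abs_exp_sub_one_sub_id_le (x := -x) (by rwa [abs_neg, abs_of_nonneg hx])
    have h2 := le_abs_self (Real.exp (-x) - 1 - -x)
    nlinarith
  · have : Real.exp (-x) ≤ 1 := Real.exp_le_one_iff.2 (by linarith)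
    nlinarith

lemma le_integral_jumpLaw {K N : ℕ} (hK : K ≤ N) :
    (∑ k ∈ Finset.range K, ((k : ℝ) + 1) * r k.succPNat)
      * (1 - ∑ j ∈ Finset.range K, (r j.succPNat : ℝ)) ≤ ∫ n, (n : ℝ) ∂jumpLaw r N := by
  rw [integral_jumpLaw r N fun n => (n : ℝ)]
  have hi2 : ∀ k, Integrable (fun c => ∑ j ∈ (Finset.range K).erase k,
      attempted c k * attempted c j) (Measure.infinitePi fun k => countLaw (r k)) := fun k =>
    integrable_finsetSum _ fun j _ => integrable_attempted_mul r k j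
  have hi1 : ∀ k, Integrable (fun c => attempted c k - ∑ j ∈ (Finset.range K).erase k,
      attempted c k * attempted c j) (Measure.infinitePi fun k => countLaw (r k)) := fun k =>
    (integrable_attempted r k).sub (hi2 k)
  have hi : ∀ k ∈ Finset.range K, Integrable (fun c => ((k : ℝ) + 1) *
      (attempted c k - ∑ j ∈ (Finset.range K).erase k, attempted c k * attempted c j))
      (Measure.infinitePi fun k => countLaw (r k)) := fun k _ => (hi1 k).const_mul _
  refine le_trans ?_ (integral_mono (integrable_finsetSum _ hi)
    (by simpa using integrable_largestJump_pow r N 1) (le_largestJump_sum hK))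
  rw [integral_finsetSum _ hi, Finset.sum_mul]
  refine Finset.sum_le_sum fun k hk => ?_
  rw [integral_const_mul, integral_sub (integrable_attempted r k) (hi2 k), integral_attempted,
    integral_finsetSum _ fun j _ => integrable_attempted_mul r k j, mul_assoc]
  refine mul_le_mul_of_nonneg_left ?_ (by positivity)
  have hp : ∀ j : ℕ, 0 ≤ 1 - Real.exp (-r j.succPNat) ∧
      1 - Real.exp (-r j.succPNat) ≤ r j.succPNat := fun j => by
    have h1 := Real.add_one_le_exp (-(r j.succPNat : ℝ))
    have h2 : Real.exp (-(r j.succPNat : ℝ)) ≤ 1 :=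
      Real.exp_le_one_iff.2 (neg_nonpos.2 (r j.succPNat).2)
    constructor <;> linarith
  have h1 : ∑ j ∈ (Finset.range K).erase k,
      ∫ c, attempted c k * attempted c j ∂(Measure.infinitePi fun k => countLaw (r k))
      ≤ ∑ j ∈ (Finset.range K).erase k, (r k.succPNat : ℝ) * r j.succPNat :=
    Finset.sum_le_sum fun j hj => by
      rw [integral_attempted_mul r (Finset.ne_of_mem_erase hj).symm]
      exact mul_le_mul (hp k).2 (hp j).2 (hp j).1 (r k.succPNat).2
  have h2 := sub_sq_le_one_sub_exp_neg (r k.succPNat).2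
  have h3 := Finset.add_sum_erase (Finset.range K) (fun j => (r j.succPNat : ℝ)) hk
  rw [← Finset.mul_sum] at h1
  simp only [NNReal.val_eq_coe] at h2
  rw [← h3]
  nlinarith

end Moments

/-! ### The mean displacement in continuous time -/

/-- The law of the largest jump of at most `N` steps that a particle attempts in a time interval
of length `2⁻ᴺ`. -/
def stepLaw (β : ℕ+ → ℝ≥0) (N : ℕ) : Measure ℕ :=
  jumpLaw (fun k => β k * ((2 : ℝ≥0) ^ N)⁻¹) N

instance (β : ℕ+ → ℝ≥0) (N : ℕ) : IsProbabilityMeasure (stepLaw β N) := by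
  unfold stepLaw; infer_instance

lemma memLp_stepLaw (β : ℕ+ → ℝ≥0) (N : ℕ) : MemLp (fun n : ℕ => (n : ℝ)) 2 (stepLaw β N) :=
  memLp_jumpLaw _ N

/-- The `p`-th moment `∑ kᵖ β_k` of the rates. For `p = 1` this is the drift of a particle that
is never blocked. -/
def rateMoment (β : ℕ+ → ℝ≥0) (p : ℕ) : ℝ := ∑' k : ℕ, ((k : ℝ) + 1) ^ p * β k.succPNat

section Mean

variable {β : ℕ+ → ℝ≥0}

lemma rateMoment_nonneg (p : ℕ) : 0 ≤ rateMoment β p :=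
  tsum_nonneg fun k => mul_nonneg (by positivity) (β k.succPNat).2

lemma summable_rateMoment_two (hβ : Summable fun k : ℕ+ => ((k : ℕ) : ℝ) ^ 2 * (β k : ℝ)) :
    Summable fun k : ℕ => ((k : ℝ) + 1) ^ 2 * (β k.succPNat : ℝ) := by
  have h := hβ.comp_injective Nat.succPNat_injective
  refine h.congr fun k => ?_
  simp

lemma summable_rateMoment (hβ : Summable fun k : ℕ+ => ((k : ℕ) : ℝ) ^ 2 * (β k : ℝ)) {p : ℕ}
    (hp : p ≤ 2) : Summable fun k : ℕ => ((k : ℝ) + 1) ^ p * (β k.succPNat : ℝ) := by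
  refine Summable.of_nonneg_of_le (fun k => mul_nonneg (by positivity) (β k.succPNat).2)
    (fun k => ?_) (summable_rateMoment_two hβ)
  refine mul_le_mul_of_nonneg_right (pow_le_pow_right₀ ?_ hp) (β k.succPNat).2
  linarith [(Nat.cast_nonneg k : (0 : ℝ) ≤ k)]

variable (hβ : Summable fun k : ℕ+ => ((k : ℕ) : ℝ) ^ 2 * (β k : ℝ))

include hβ in
lemma integral_pow_stepLaw_le (N : ℕ) {p : ℕ} (hp0 : p ≠ 0) (hp : p ≤ 2) :
    2 ^ N * ∫ n, (n : ℝ) ^ p ∂stepLaw β N ≤ rateMoment β p := by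
  have h := integral_pow_jumpLaw_le (fun k => β k * ((2 : ℝ≥0) ^ N)⁻¹) N p hp0
  have h2 := (summable_rateMoment hβ hp).sum_le_tsum (Finset.range N)
    fun k _ => mul_nonneg (by positivity) (β k.succPNat).2
  rw [stepLaw, rateMoment]
  refine le_trans ?_ h2
  calc _ ≤ (2 : ℝ) ^ N * ∑ k ∈ Finset.range N, ((k : ℝ) + 1) ^ p *
        ((β k.succPNat * ((2 : ℝ≥0) ^ N)⁻¹ : ℝ≥0) : ℝ) :=
        mul_le_mul_of_nonneg_left h (by positivity)
    _ = _ := by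
      rw [Finset.mul_sum]
      refine Finset.sum_congr rfl fun k _ => ?_
      push_cast
      field_simp
      rfl

/-- The mean displacement of particle `-m` at the integer time `n`, in the approximation of mesh
`2⁻ᴺ`. -/
def approxMean (β : ℕ+ → ℝ≥0) (N m n : ℕ) : ℝ := meanDisp (stepLaw β N) m (2 ^ N * n)

/-- The mean displacement of particle `-m` at the integer time `n`. -/
def limMean (β : ℕ+ → ℝ≥0) (m n : ℕ) : ℝ := ⨆ N, approxMean β N m n

include hβ in
lemma approxMean_le (N m n : ℕ) : approxMean β N m n ≤ rateMoment β 1 * n := by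
  refine (meanDisp_le (memLp_stepLaw β N) _ _).trans ?_
  have h := integral_pow_stepLaw_le hβ N one_ne_zero one_le_two
  simp only [pow_one] at h
  push_cast
  calc _ = (2 ^ N * ∫ n, (n : ℝ) ∂stepLaw β N) * n := by ring
    _ ≤ _ := mul_le_mul_of_nonneg_right h (Nat.cast_nonneg n)

include hβ in
lemma integral_disp_stepLaw_sq_le (N m n : ℕ) :
    ∫ g, (disp g m (2 ^ N * n) : ℝ) ^ 2 ∂fieldLaw (stepLaw β N)
      ≤ rateMoment β 2 * n + (rateMoment β 1 * n) ^ 2 := by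
  refine (integral_disp_sq_le (memLp_stepLaw β N) _ _).trans ?_
  have h1 := integral_pow_stepLaw_le hβ N one_ne_zero one_le_two
  have h2 := integral_pow_stepLaw_le hβ N two_ne_zero le_rfl
  simp only [pow_one] at h1
  have hn : (0 : ℝ) ≤ n := Nat.cast_nonneg n
  have h0 : 0 ≤ ∫ n, (n : ℝ) ∂stepLaw β N := integral_nonneg fun _ => Nat.cast_nonneg _
  push_cast
  refine add_le_add ?_ (pow_le_pow_left₀ (by positivity) ?_ 2)
  · calc _ = (2 ^ N * ∫ n, (n : ℝ) ^ 2 ∂stepLaw β N) * n := by ring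
      _ ≤ _ := mul_le_mul_of_nonneg_right h2 hn
  · calc _ = (2 ^ N * ∫ n, (n : ℝ) ∂stepLaw β N) * n := by ring
      _ ≤ _ := mul_le_mul_of_nonneg_right h1 hn

include hβ in
lemma bddAbove_approxMean (m n : ℕ) : BddAbove (range fun N => approxMean β N m n) :=
  ⟨rateMoment β 1 * n, by rintro _ ⟨N, rfl⟩; exact approxMean_le hβ N m n⟩

include hβ in
lemma approxMean_le_limMean (N m n : ℕ) : approxMean β N m n ≤ limMean β m n :=
  le_ciSup (bddAbove_approxMean hβ m n) N

include hβ in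
lemma limMean_le (m n : ℕ) : limMean β m n ≤ rateMoment β 1 * n :=
  ciSup_le fun N => approxMean_le hβ N m n

lemma limMean_nonneg (m n : ℕ) : 0 ≤ limMean β m n :=
  Real.iSup_nonneg fun _ => meanDisp_nonneg _ _ _

include hβ in
lemma limMean_antitone (n : ℕ) : Antitone fun m => limMean β m n := fun _ _ h =>
  ciSup_mono (bddAbove_approxMean hβ _ n) fun N => meanDisp_antitone (memLp_stepLaw β N) _ h

include hβ in
lemma limMean_add_le (m m' n n' : ℕ) :
    limMean β (m + m') (n + n') ≤ limMean β m n + limMean β m' n' := by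
  refine ciSup_le fun N => ?_
  have h := meanDisp_add_le (memLp_stepLaw β N) m m' (2 ^ N * n) (2 ^ N * n')
  rw [← mul_add] at h
  exact h.trans (add_le_add (approxMean_le_limMean hβ N m n) (approxMean_le_limMean hβ N m' n'))

include hβ in
lemma limMean_mul_le (p m n : ℕ) : limMean β (p * m) (p * n) ≤ p * limMean β m n := by
  induction p with
  | zero => simpa using limMean_le hβ 0 0
  | succ p ih =>
    have h := limMean_add_le hβ (p * m) m (p * n) n
    rw [Nat.succ_mul, Nat.succ_mul]
    push_cast
    linarith

include hβ in
/-- A small number of particles ahead slows a particle down only a little. This is what makes the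
limit shape continuous at the front of the configuration. -/
lemma exists_le_limMean {δ : ℝ} (hδ : 0 < δ) :
    ∃ C, 0 ≤ C ∧ ∀ m n : ℕ, (rateMoment β 1 - δ) * n - C * m ≤ limMean β m n := by
  have hs := (summable_rateMoment hβ one_le_two).hasSum.tendsto_sum_nat
  obtain ⟨K, hK⟩ := (hs.eventually_const_lt (show rateMoment β 1 - δ / 4
    < ∑' k : ℕ, ((k : ℝ) + 1) ^ 1 * (β k.succPNat : ℝ) by rw [← rateMoment]; linarith)).exists
  simp only [pow_one] at hK
  set S := ∑ k ∈ Finset.range K, ((k : ℝ) + 1) * (β k.succPNat : ℝ)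
  set B := ∑ k ∈ Finset.range K, (β k.succPNat : ℝ)
  -- One fixed mesh, for which the mean attempt per unit time is close to the unblocked drift, is
  -- enough, since `limMean` is at least each of the approximate means.
  obtain ⟨N, hNK, hN⟩ : ∃ N, K ≤ N ∧ S * B * (2⁻¹ : ℝ) ^ N < δ / 4 := by
    have h : Tendsto (fun N : ℕ => S * B * (2⁻¹ : ℝ) ^ N) atTop (𝓝 (S * B * 0)) :=
      (tendsto_pow_atTop_nhds_zero_of_lt_one (by norm_num) (by norm_num)).const_mul _
    rw [mul_zero] at h
    exact ((eventually_ge_atTop K).and (h.eventually_lt_const (by positivity))).exists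
  set e1 := ∫ n, (n : ℝ) ∂stepLaw β N
  set e2 := ∫ n, (n : ℝ) ^ 2 ∂stepLaw β N
  have h2N : (0 : ℝ) < 2 ^ N := by positivity
  have he1 : rateMoment β 1 - δ / 2 ≤ 2 ^ N * e1 := by
    have h := le_integral_jumpLaw (fun k => β k * ((2 : ℝ≥0) ^ N)⁻¹) hNK
    push_cast at h
    simp only [← mul_assoc] at h
    rw [← Finset.sum_mul, ← Finset.sum_mul] at h
    have h' := mul_le_mul_of_nonneg_left h h2N.le
    have h'' : 2 ^ N * (S * (2 ^ N)⁻¹ * (1 - B * (2 ^ N)⁻¹)) = S - S * B * (2⁻¹ : ℝ) ^ N := by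
      rw [inv_pow]; field_simp
    rw [h''] at h'
    change _ ≤ 2 ^ N * e1 at h'
    linarith
  have he2 : 2 ^ N * e2 ≤ rateMoment β 2 := integral_pow_stepLaw_le hβ N two_ne_zero le_rfl
  have hM2 := rateMoment_nonneg (β := β) 2
  obtain ⟨θ, hθ, hθM⟩ : ∃ θ : ℝ, 0 < θ ∧ θ * rateMoment β 2 ≤ δ / 4 := by
    refine ⟨δ / 4 / (rateMoment β 2 + 1), by positivity, ?_⟩
    rw [div_mul_eq_mul_div, div_le_iff₀ (by positivity)]
    nlinarith
  obtain ⟨A, hA, hAδ⟩ : ∃ A : ℝ, 1 ≤ A ∧ 2 ^ N * A⁻¹ ≤ θ * (δ / 4) := by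
    refine ⟨1 + 2 ^ N / (θ * (δ / 4)), by linarith [show 0 < 2 ^ N / (θ * (δ / 4)) by positivity],
      ?_⟩
    rw [← div_eq_mul_inv, div_le_iff₀ (by positivity), mul_add, mul_one,
      mul_div_cancel₀ _ (by positivity)]
    linarith [show 0 < θ * (δ / 4) by positivity]
  set ρ := ∫ n : ℕ, Real.exp (-θ * n) ∂stepLaw β N
  have hρ : θ * e1 - θ ^ 2 * e2 ≤ 1 - ρ := by
    have hi1 : Integrable (fun n : ℕ => (n : ℝ)) (stepLaw β N) :=
      (memLp_stepLaw β N).integrable (by norm_num)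
    have hi2 : Integrable (fun n : ℕ => (n : ℝ) ^ 2) (stepLaw β N) :=
      (memLp_stepLaw β N).integrable_sq
    have hi3 : Integrable (fun n : ℕ => Real.exp (-θ * n)) (stepLaw β N) :=
      integrable_exp_neg (X := fun n : ℕ => n) measurable_id hθ.le
    have h1 : ∫ n : ℕ, (θ * (n : ℝ) - θ ^ 2 * (n : ℝ) ^ 2) ∂stepLaw β N = θ * e1 - θ ^ 2 * e2 := by
      rw [integral_sub (hi1.const_mul _) (hi2.const_mul _), integral_const_mul,
        integral_const_mul]
    have h2 : ∫ n : ℕ, (1 - Real.exp (-θ * n)) ∂stepLaw β N = 1 - ρ := by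
      rw [integral_sub (integrable_const _) hi3]
      simp [ρ]
    rw [← h1, ← h2]
    refine integral_mono ((hi1.const_mul _).sub (hi2.const_mul _))
      ((integrable_const _).sub hi3) fun n => ?_
    have := sub_sq_le_one_sub_exp_neg (x := θ * n) (by positivity)
    simp only [mul_pow, ← neg_mul] at this
    exact this
  have hrate : (rateMoment β 1 - δ) * θ ≤ 2 ^ N * (1 - ρ - A⁻¹) := by
    have h1 := mul_le_mul_of_nonneg_left hρ h2N.le
    have h2 := mul_le_mul_of_nonneg_left he1 hθ.le
    have h3 := mul_le_mul_of_nonneg_left (mul_le_mul_of_nonneg_left he2 hθ.le) hθ.le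
    have h4 := mul_le_mul_of_nonneg_left hθM hθ.le
    nlinarith
  refine ⟨Real.log A / θ, div_nonneg (Real.log_nonneg hA) hθ.le, fun m n => ?_⟩
  refine le_trans ?_ (approxMean_le_limMean hβ N m n)
  refine le_trans ?_ (le_meanDisp (memLp_stepLaw β N) hθ hA m (2 ^ N * n))
  rw [le_div_iff₀ hθ]
  have h := mul_le_mul_of_nonneg_right hrate (Nat.cast_nonneg n : (0 : ℝ) ≤ n)
  have h' : Real.log A / θ * m * θ = m * Real.log A := by field_simp
  push_cast
  nlinarith

end Mean

/-! ### The limit shape -/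

/-- The asymptotic displacement per unit time of the particles `-⌊y n⌋` at time `n`, for
`y ≥ 0`. By subadditivity the limit is an infimum. -/
def asympDisp (β : ℕ+ → ℝ≥0) (y : ℝ) : ℝ :=
  sInf ((fun n : ℕ => limMean β ⌊y * n⌋₊ n / n) '' Ici 1)

section Shape

variable {β : ℕ+ → ℝ≥0} {y : ℝ}

lemma bddBelow_asympDisp (y : ℝ) :
    BddBelow ((fun n : ℕ => limMean β ⌊y * n⌋₊ n / n) '' Ici 1) :=
  ⟨0, by rintro _ ⟨n, _, rfl⟩; exact div_nonneg (limMean_nonneg _ _) (Nat.cast_nonneg _)⟩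

variable (hβ : Summable fun k : ℕ+ => ((k : ℕ) : ℝ) ^ 2 * (β k : ℝ))

include hβ in
lemma asympDisp_mul_le {m n : ℕ} (hn : n ≠ 0) (h : (m : ℝ) ≤ y * n) :
    asympDisp β y * n ≤ limMean β m n := by
  have hn' : (0 : ℝ) < n := by exact_mod_cast Nat.pos_of_ne_zero hn
  rw [← le_div_iff₀ hn']
  refine (csInf_le (bddBelow_asympDisp y) ⟨n, Nat.one_le_iff_ne_zero.2 hn, rfl⟩).trans ?_
  exact div_le_div_of_nonneg_right (limMean_antitone hβ n (Nat.le_floor h)) hn'.le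

lemma exists_limMean_lt (hy : 0 ≤ y) {b : ℝ} (hb : asympDisp β y < b) :
    ∃ m n : ℕ, n ≠ 0 ∧ (m : ℝ) ≤ y * n ∧ limMean β m n < b * n := by
  obtain ⟨_, ⟨n, hn, rfl⟩, h⟩ := exists_lt_of_csInf_lt ((nonempty_Ici).image _) hb
  have hn' : (0 : ℝ) < n := by exact_mod_cast hn
  exact ⟨⌊y * n⌋₊, n, Nat.one_le_iff_ne_zero.1 hn, Nat.floor_le (by positivity),
    (div_lt_iff₀ hn').1 h⟩

include hβ in
lemma asympDisp_convex_nat {y₁ y₂ : ℝ} (hy₁ : 0 ≤ y₁) (hy₂ : 0 ≤ y₂) {p q : ℕ} (hpq : p + q ≠ 0)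
    (h : p * y₁ + q * y₂ ≤ (p + q) * y) :
    (p + q) * asympDisp β y ≤ p * asympDisp β y₁ + q * asympDisp β y₂ := by
  refine le_of_forall_pos_le_add fun ε hε => ?_
  have hpq' : (0 : ℝ) < p + q := by exact_mod_cast Nat.pos_of_ne_zero hpq
  obtain ⟨m₁, n₁, hn₁, hm₁, hf₁⟩ := exists_limMean_lt (β := β) hy₁
    (lt_add_of_pos_right (asympDisp β y₁) (div_pos hε hpq'))
  obtain ⟨m₂, n₂, hn₂, hm₂, hf₂⟩ := exists_limMean_lt (β := β) hy₂
    (lt_add_of_pos_right (asympDisp β y₂) (div_pos hε hpq'))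
  have hn₁' : (0 : ℝ) < n₁ := by exact_mod_cast Nat.pos_of_ne_zero hn₁
  have hn₂' : (0 : ℝ) < n₂ := by exact_mod_cast Nat.pos_of_ne_zero hn₂
  -- Particle counts and times are scaled so that both blocks last for `n₁ * n₂` units of time.
  have h1 := limMean_add_le hβ (p * n₂ * m₁) (q * n₁ * m₂) (p * n₂ * n₁) (q * n₁ * n₂)
  have h2 := limMean_mul_le hβ (p * n₂) m₁ n₁
  have h3 := limMean_mul_le hβ (q * n₁) m₂ n₂
  have hn : p * n₂ * n₁ + q * n₁ * n₂ ≠ 0 := by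
    have : p * n₂ * n₁ + q * n₁ * n₂ = (p + q) * (n₁ * n₂) := by ring
    rw [this]
    exact mul_ne_zero hpq (mul_ne_zero hn₁ hn₂)
  have h4 := asympDisp_mul_le hβ (y := y) (m := p * n₂ * m₁ + q * n₁ * m₂) hn (by
    push_cast
    have e1 := mul_le_mul_of_nonneg_left hm₁ (by positivity : (0 : ℝ) ≤ p * n₂)
    have e2 := mul_le_mul_of_nonneg_left hm₂ (by positivity : (0 : ℝ) ≤ q * n₁)
    have e3 := mul_le_mul_of_nonneg_left h (by positivity : (0 : ℝ) ≤ n₁ * n₂)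
    nlinarith)
  push_cast at h2 h3 h4
  have e1 := mul_le_mul_of_nonneg_left hf₁.le (by positivity : (0 : ℝ) ≤ p * n₂)
  have e2 := mul_le_mul_of_nonneg_left hf₂.le (by positivity : (0 : ℝ) ≤ q * n₁)
  have e3 : (n₁ * n₂ : ℝ) * ((p + q) * asympDisp β y)
      ≤ (n₁ * n₂ : ℝ) * (p * asympDisp β y₁ + q * asympDisp β y₂ + (p + q) * (ε / (p + q))) := by
    nlinarith
  have e4 := le_of_mul_le_mul_left e3 (by positivity)
  rwa [mul_div_cancel₀ _ hpq'.ne'] at e4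

include hβ in
lemma asympDisp_antitoneOn : AntitoneOn (asympDisp β) (Ici 0) := by
  intro y₁ hy₁ y₂ hy₂ h
  have := asympDisp_convex_nat hβ (y := y₂) (p := 1) (q := 0) hy₁ hy₂ (by norm_num)
    (by simpa using h)
  simpa using this

include hβ in
lemma asympDisp_convex_of_le {y₁ y₂ s t : ℝ} (hy₁ : 0 ≤ y₁) (h : y₁ ≤ y₂) (hs : 0 ≤ s)
    (ht : 0 ≤ t) (hst : s + t = 1) :
    asympDisp β (s * y₁ + t * y₂) ≤ s * asympDisp β y₁ + t * asympDisp β y₂ := by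
  have hy₂ := hy₁.trans h
  have ha := asympDisp_antitoneOn hβ hy₁ hy₂ h
  -- The weight of `y₁` is rounded up to a rational number; by monotonicity this only moves the
  -- point in the favourable direction.
  have key : ∀ n : ℕ, 0 < n → asympDisp β (s * y₁ + t * y₂) ≤ s * asympDisp β y₁
      + t * asympDisp β y₂ + (asympDisp β y₁ - asympDisp β y₂) / n := by
    intro n hn
    have hn' : (0 : ℝ) < n := by exact_mod_cast hn
    have hp : ⌈s * n⌉₊ ≤ n := Nat.ceil_le.2 (by nlinarith)
    have hp1 : s * n ≤ ⌈s * n⌉₊ := Nat.le_ceil _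
    have hp2 : (⌈s * n⌉₊ : ℝ) < s * n + 1 := Nat.ceil_lt_add_one (by positivity)
    set p := ⌈s * n⌉₊
    have hq : ((n - p : ℕ) : ℝ) = n - p := Nat.cast_sub hp
    have hc := asympDisp_convex_nat hβ (y := s * y₁ + t * y₂) (p := p) (q := n - p) hy₁ hy₂
      (by omega) (by
        rw [hq, show t = 1 - s by linarith]
        nlinarith)
    rw [hq] at hc
    rw [← mul_le_mul_iff_right₀ hn']
    have e : (n : ℝ) * (s * asympDisp β y₁ + t * asympDisp β y₂
        + (asympDisp β y₁ - asympDisp β y₂) / n) = n * asympDisp β y₂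
        + (s * n + 1) * (asympDisp β y₁ - asympDisp β y₂) := by
      rw [show t = 1 - s by linarith]; field_simp; ring
    rw [e]
    nlinarith
  have hlim : Tendsto (fun n : ℕ => s * asympDisp β y₁ + t * asympDisp β y₂
      + (asympDisp β y₁ - asympDisp β y₂) / n) atTop
      (𝓝 (s * asympDisp β y₁ + t * asympDisp β y₂ + 0)) :=
    tendsto_const_nhds.add (tendsto_const_div_atTop_nhds_zero_nat _)
  rw [add_zero] at hlim
  exact ge_of_tendsto hlim ((eventually_gt_atTop 0).mono key)

include hβ in
lemma convexOn_asympDisp : ConvexOn ℝ (Ici 0) (asympDisp β) := by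
  refine ⟨convex_Ici 0, fun y₁ hy₁ y₂ hy₂ s t hs ht hst => ?_⟩
  simp only [smul_eq_mul]
  rcases le_total y₁ y₂ with h | h
  · exact asympDisp_convex_of_le hβ hy₁ h hs ht hst
  · rw [add_comm (s * y₁), add_comm (s * asympDisp β y₁)]
    exact asympDisp_convex_of_le hβ hy₂ h ht hs (by rw [add_comm, hst])

include hβ in
lemma asympDisp_le (hy : 0 ≤ y) : asympDisp β y ≤ rateMoment β 1 := by
  have h := asympDisp_mul_le hβ (y := y) (m := 0) (n := 1) one_ne_zero (by simpa using hy)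
  have h' := limMean_le hβ 0 1
  simp only [Nat.cast_one, mul_one] at h h'
  exact h.trans h'

include hβ in
lemma exists_le_asympDisp {δ : ℝ} (hδ : 0 < δ) :
    ∃ C, 0 ≤ C ∧ ∀ y, 0 ≤ y → rateMoment β 1 - δ - C * y ≤ asympDisp β y := by
  obtain ⟨C, hC, h⟩ := exists_le_limMean hβ hδ
  refine ⟨C, hC, fun y hy => le_csInf ((nonempty_Ici).image _) ?_⟩
  rintro _ ⟨n, hn, rfl⟩
  have hn' : (0 : ℝ) < n := by exact_mod_cast hn
  rw [le_div_iff₀ hn']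
  have h1 := h ⌊y * n⌋₊ n
  have h2 := mul_le_mul_of_nonneg_left
    (Nat.floor_le (by positivity : 0 ≤ y * n)) hC
  linarith

include hβ in
lemma continuousOn_asympDisp : ContinuousOn (asympDisp β) (Ici 0) := by
  refine (convexOn_asympDisp hβ).continuousOn_Ici ?_
  have h0 : asympDisp β 0 = rateMoment β 1 := by
    refine le_antisymm (asympDisp_le hβ le_rfl) (le_of_forall_pos_le_add fun δ hδ => ?_)
    obtain ⟨C, _, h⟩ := exists_le_asympDisp hβ hδ
    have := h 0 le_rfl
    linarith
  rw [Metric.continuousWithinAt_iff]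
  intro ε hε
  obtain ⟨C, hC, h⟩ := exists_le_asympDisp hβ (half_pos hε)
  refine ⟨ε / 2 / (C + 1), by positivity, fun {y} hy hd => ?_⟩
  rw [Real.dist_eq, sub_zero, abs_of_nonneg hy, lt_div_iff₀ (by positivity)] at hd
  have h1 := h y hy
  have h2 := asympDisp_le hβ hy
  have hy' : 0 ≤ y := hy
  rw [Real.dist_eq, h0, abs_sub_lt_iff]
  constructor <;> nlinarith

end Shape

/-! ### The law of large numbers along the integer times -/

section LawOfLargeNumbers

variable {β : ℕ+ → ℝ≥0} {y b ε : ℝ}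
  (hβ : Summable fun k : ℕ+ => ((k : ℕ) : ℝ) ^ 2 * (β k : ℝ))

include hβ in
/-- The excess over the limit shape is negligible in mean, uniformly in the mesh. -/
lemma eventually_integral_disp_sub_pos_le (hy : 0 ≤ y) (hb : asympDisp β y < b) (hε : 0 < ε) :
    ∀ᶠ n : ℕ in atTop, ∀ N, ∫ g, max ((disp g ⌊y * n⌋₊ (2 ^ N * n) : ℝ) - b * n) 0
      ∂fieldLaw (stepLaw β N) ≤ ε * n := by
  -- The time `n` is cut into blocks of the length `r` for which the mean is already below `b r`.
  obtain ⟨m, r, hr, hm, hf⟩ := exists_limMean_lt hy hb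
  have hr' : (0 : ℝ) < r := by exact_mod_cast Nat.pos_of_ne_zero hr
  have hb0 : 0 < b := by
    have := (limMean_nonneg (β := β) m r).trans_lt hf
    exact pos_of_mul_pos_left this hr'.le
  set V := rateMoment β 2 * r + (rateMoment β 1 * r) ^ 2
  have hV : 0 ≤ V := add_nonneg (mul_nonneg (rateMoment_nonneg 2) hr'.le) (sq_nonneg _)
  have hlim : Tendsto (fun n : ℕ => √V / √(n : ℝ) + rateMoment β 1 * r / n) atTop (𝓝 (0 + 0)) :=
    ((tendsto_const_nhds.div_atTop (Real.tendsto_sqrt_atTop.comp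
      tendsto_natCast_atTop_atTop))).add (tendsto_const_div_atTop_nhds_zero_nat _)
  rw [add_zero] at hlim
  filter_upwards [hlim.eventually_lt_const hε, eventually_gt_atTop 0] with n hn hn0 N
  have hn' : (0 : ℝ) < n := by exact_mod_cast hn0
  set q := n / r
  have hq1 : q * r ≤ n := Nat.div_mul_le_self n r
  have hq2 : n ≤ (q + 1) * r := by
    rw [mul_comm]; exact (Nat.lt_mul_div_succ n (Nat.pos_of_ne_zero hr)).le
  have hq1' : (q : ℝ) * r ≤ n := by exact_mod_cast hq1
  have hqm : q * m ≤ ⌊y * n⌋₊ := by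
    refine Nat.le_floor ?_
    push_cast
    nlinarith [mul_le_mul_of_nonneg_left hm (Nat.cast_nonneg q : (0 : ℝ) ≤ q),
      mul_le_mul_of_nonneg_left hq1' hy]
  have hdom : ∀ g, disp g ⌊y * n⌋₊ (2 ^ N * n) ≤ disp g (q * m) ((q + 1) * (2 ^ N * r)) := by
    intro g
    refine (disp_antitone_left g _ hqm).trans (disp_mono_right g _ ?_)
    calc 2 ^ N * n ≤ 2 ^ N * ((q + 1) * r) := Nat.mul_le_mul_left _ hq2
      _ = _ := by ring
  have hint : ∀ m l, Integrable (fun g => max ((disp g m l : ℝ) - b * n) 0)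
      (fieldLaw (stepLaw β N)) := fun m l =>
    ((integrable_disp (memLp_stepLaw β N) m l).sub (integrable_const (b * n))).pos_part
  have h1 := integral_disp_sub_pos_le (memLp_stepLaw β N) m (2 ^ N * r) q (c := b * n)
    (integral_disp_stepLaw_sq_le hβ N m r)
  have h2 : max (q * meanDisp (stepLaw β N) m (2 ^ N * r) - b * n) 0 = 0 := by
    refine max_eq_right ?_
    have h3 : meanDisp (stepLaw β N) m (2 ^ N * r) ≤ b * r :=
      (approxMean_le_limMean hβ N m r).trans hf.le
    nlinarith [mul_le_mul_of_nonneg_left h3 (Nat.cast_nonneg q : (0 : ℝ) ≤ q)]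
  have h3 : meanDisp (stepLaw β N) 0 (2 ^ N * r) ≤ rateMoment β 1 * r := approxMean_le hβ N 0 r
  rw [h2] at h1
  have h4 : √(q * V) ≤ √V / √(n : ℝ) * n := by
    have : √V / √(n : ℝ) * n = √(n * V) := by
      rw [Real.sqrt_mul hn'.le, div_mul_eq_mul_div, div_eq_iff (by positivity), mul_right_comm,
        Real.mul_self_sqrt hn'.le, mul_comm]
    rw [this]
    refine Real.sqrt_le_sqrt (mul_le_mul_of_nonneg_right ?_ hV)
    exact_mod_cast Nat.div_le_self n r
  have h5 : rateMoment β 1 * r / n * n = rateMoment β 1 * r := by field_simp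
  calc _ ≤ ∫ g, max ((disp g (q * m) ((q + 1) * (2 ^ N * r)) : ℝ) - b * n) 0
        ∂fieldLaw (stepLaw β N) := integral_mono (hint _ _) (hint _ _) fun g =>
          max_le_max (sub_le_sub_right (Nat.cast_le.2 (hdom g)) _) le_rfl
    _ ≤ √V / √(n : ℝ) * n + rateMoment β 1 * r / n * n := by linarith
    _ ≤ ε * n := by
      rw [← add_mul]
      exact mul_le_mul_of_nonneg_right hn.le hn'.le

include hβ in
lemma eventually_upper_tail_le (hy : 0 ≤ y) (hb : asympDisp β y < b) (hε : 0 < ε) :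
    ∀ᶠ n : ℕ in atTop, ∀ N, (fieldLaw (stepLaw β N)).real
      {g | b * n < disp g ⌊y * n⌋₊ (2 ^ N * n)} ≤ ε := by
  obtain ⟨b', hb', hbb'⟩ := exists_between hb
  have hd : 0 < b - b' := sub_pos.2 hbb'
  filter_upwards [eventually_integral_disp_sub_pos_le hβ hy hb' (mul_pos hε hd),
    eventually_gt_atTop 0] with n hn hn0 N
  have hn' : (0 : ℝ) < n := by exact_mod_cast hn0
  have hmarkov := mul_meas_ge_le_integral_of_nonneg (μ := fieldLaw (stepLaw β N))
    (f := fun g => max ((disp g ⌊y * n⌋₊ (2 ^ N * n) : ℝ) - b' * n) 0)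
    (ae_of_all _ fun g => le_max_right _ _)
    (((integrable_disp (memLp_stepLaw β N) _ _).sub (integrable_const (b' * n))).pos_part)
    ((b - b') * n)
  have hsub : (fieldLaw (stepLaw β N)).real {g | b * n < disp g ⌊y * n⌋₊ (2 ^ N * n)}
      ≤ (fieldLaw (stepLaw β N)).real
        {g | (b - b') * n ≤ max ((disp g ⌊y * n⌋₊ (2 ^ N * n) : ℝ) - b' * n) 0} :=
    measureReal_mono fun g hg => by
      have h1 : b * n < disp g ⌊y * n⌋₊ (2 ^ N * n) := hg
      have h2 := le_max_left ((disp g ⌊y * n⌋₊ (2 ^ N * n) : ℝ) - b' * n) 0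
      show (b - b') * n ≤ max ((disp g ⌊y * n⌋₊ (2 ^ N * n) : ℝ) - b' * n) 0
      linarith
  have h := hmarkov.trans (hn N)
  have hpos : 0 < (b - b') * n := mul_pos hd hn'
  refine hsub.trans (le_of_mul_le_mul_left ?_ hpos)
  linarith

include hβ in
/-- If the mean is close to the limit shape, then so is most of the mass, since the excess over
the limit shape is negligible. -/
lemma eventually_lower_tail_le (hy : 0 ≤ y) (hb : b < asympDisp β y) (hε : 0 < ε) :
    ∀ᶠ n : ℕ in atTop, ∀ N, (asympDisp β y - ε) * n ≤ approxMean β N ⌊y * n⌋₊ n →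
      (fieldLaw (stepLaw β N)).real {g | (disp g ⌊y * n⌋₊ (2 ^ N * n) : ℝ) < b * n}
        ≤ 3 * ε / (asympDisp β y - b) := by
  set a := asympDisp β y
  have hd : 0 < a - b := sub_pos.2 hb
  filter_upwards [eventually_integral_disp_sub_pos_le hβ hy (lt_add_of_pos_right a hε) hε,
    eventually_gt_atTop 0] with n hn hn0 N hN
  have hn' : (0 : ℝ) < n := by exact_mod_cast hn0
  set m := ⌊y * n⌋₊
  set l := 2 ^ N * n
  set E : Set (ℕ × ℕ → ℕ) := {g | (disp g m l : ℝ) < b * n} with hE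
  have hEm : MeasurableSet E :=
    (measurable_of_countable (fun n : ℕ => (n : ℝ))).comp (measurable_disp_field m l)
      measurableSet_Iio
  have hi1 : Integrable (fun g => max ((disp g m l : ℝ) - (a + ε) * n) 0)
      (fieldLaw (stepLaw β N)) :=
    ((integrable_disp (memLp_stepLaw β N) m l).sub (integrable_const ((a + ε) * n))).pos_part
  have hi2 : Integrable (E.indicator fun _ => (a - b) * n) (fieldLaw (stepLaw β N)) :=
    (integrable_const _).indicator hEm
  have hi3 : Integrable (fun g => (a + ε) * n + max ((disp g m l : ℝ) - (a + ε) * n) 0)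
      (fieldLaw (stepLaw β N)) := (integrable_const _).add hi1
  have h : approxMean β N m n ≤ ∫ g, ((a + ε) * n + max ((disp g m l : ℝ) - (a + ε) * n) 0
      - E.indicator (fun _ => (a - b) * n) g) ∂fieldLaw (stepLaw β N) := by
    refine integral_mono (integrable_disp (memLp_stepLaw β N) m l) (hi3.sub hi2) fun g => ?_
    by_cases hg : g ∈ E
    · have : (disp g m l : ℝ) < b * n := hg
      simp only [Set.indicator_of_mem hg]
      have := le_max_right ((disp g m l : ℝ) - (a + ε) * n) 0
      nlinarith
    · simp only [Set.indicator_of_notMem hg]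
      have := le_max_left ((disp g m l : ℝ) - (a + ε) * n) 0
      linarith
  rw [integral_sub hi3 hi2, integral_add (integrable_const _) hi1,
    integral_indicator_const _ hEm] at h
  simp only [integral_const, probReal_univ, smul_eq_mul] at h
  have h1 := hn N
  rw [le_div_iff₀ hd]
  have h2 : n * ((fieldLaw (stepLaw β N)).real E * (a - b)) ≤ n * (3 * ε) := by nlinarith
  exact le_of_mul_le_mul_left h2 hn'

variable {Ω : Type*} {mΩ : MeasurableSpace Ω} {P : Measure Ω}

lemma measure_le_of_ae_eventually_mem {A : ℕ → Set Ω} {S : Set Ω} {c : ℝ≥0∞}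
    (h : ∀ᵐ ω ∂P, ω ∈ S → ∀ᶠ N in atTop, ω ∈ A N) (hA : ∀ᶠ N in atTop, P (A N) ≤ c) :
    P S ≤ c := by
  obtain ⟨N₀, hN₀⟩ := eventually_atTop.1 hA
  have hmono : Monotone fun M => ⋂ N ≥ M, A N := fun M M' hM =>
    Set.biInter_subset_biInter_left fun N hN => le_trans hM hN
  calc P S ≤ P (⋃ M, ⋂ N ≥ M, A N) := by
        refine measure_mono_ae ?_
        filter_upwards [h] with ω hω hS
        obtain ⟨M, hM⟩ := eventually_atTop.1 (hω hS)
        exact Set.mem_iUnion.2 ⟨M, Set.mem_iInter₂.2 hM⟩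
    _ = ⨆ M, P (⋂ N ≥ M, A N) := hmono.measure_iUnion
    _ ≤ c := iSup_le fun M => (measure_mono (Set.biInter_subset_of_mem
        (le_max_left M N₀))).trans (hN₀ _ (le_max_right M N₀))

variable {G : ℕ → Ω → ℕ × ℕ → ℕ} {X : ℕ → ℕ → Ω → ℕ}

lemma measure_preimage_le {P : Measure Ω} {ν : Measure ℕ} [IsProbabilityMeasure ν]
    {F : Ω → ℕ × ℕ → ℕ} (hF : MeasurePreserving F P (fieldLaw ν)) {E : Set (ℕ × ℕ → ℕ)}
    (hE : MeasurableSet E) {c : ℝ} (hc : (fieldLaw ν).real E ≤ c) :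
    P (F ⁻¹' E) ≤ ENNReal.ofReal c := by
  rw [hF.measure_preimage hE.nullMeasurableSet]
  rw [← ofReal_measureReal]
  exact ENNReal.ofReal_le_ofReal hc

variable (hG : ∀ N, MeasurePreserving (G N) P (fieldLaw (stepLaw β N)))
  (hX : ∀ᵐ ω ∂P, ∀ m n, ∀ᶠ N in atTop, X m n ω = disp (G N ω) m (2 ^ N * n))

include hβ hG hX in
lemma tendsto_measure_upper_tail (hy : 0 ≤ y) (hb : asympDisp β y < b) :
    Tendsto (fun n : ℕ => P {ω | b * n < X ⌊y * n⌋₊ n ω}) atTop (𝓝 0) := by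
  refine ENNReal.tendsto_nhds_zero.2 fun ε hε => ?_
  obtain ⟨c, hc, hcε⟩ : ∃ c : ℝ, 0 < c ∧ ENNReal.ofReal c ≤ ε := by
    rcases eq_or_ne ε ∞ with rfl | h
    · exact ⟨1, one_pos, le_top⟩
    · exact ⟨ε.toReal, ENNReal.toReal_pos hε.ne' h, ENNReal.ofReal_toReal_le⟩
  filter_upwards [eventually_upper_tail_le hβ hy hb hc] with n hn
  refine le_trans ?_ hcε
  refine measure_le_of_ae_eventually_mem
    (A := fun N => G N ⁻¹' {g | b * n < disp g ⌊y * n⌋₊ (2 ^ N * n)}) ?_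
    (Eventually.of_forall fun N => measure_preimage_le (hG N)
      ((measurable_of_countable (fun n : ℕ => (n : ℝ))).comp (measurable_disp_field _ _)
        measurableSet_Ioi) (hn N))
  filter_upwards [hX] with ω hω hS
  filter_upwards [hω ⌊y * n⌋₊ n] with N hN
  have hS' : b * n < X ⌊y * n⌋₊ n ω := hS
  rw [hN] at hS'
  exact hS'

lemma approxMean_eq_integral (hG : ∀ N, MeasurePreserving (G N) P (fieldLaw (stepLaw β N)))
    (N m n : ℕ) : approxMean β N m n = ∫ ω, (disp (G N ω) m (2 ^ N * n) : ℝ) ∂P := by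
  rw [approxMean, meanDisp, ← (hG N).map_eq, integral_map (hG N).measurable.aemeasurable]
  exact ((measurable_of_countable (fun n : ℕ => (n : ℝ))).comp
    (measurable_disp_field _ _)).aestronglyMeasurable

include hβ hG hX in
lemma tendsto_measure_lower_tail (hmono : ∀ ω N m n,
      disp (G N ω) m (2 ^ N * n) ≤ disp (G (N + 1) ω) m (2 ^ (N + 1) * n))
    (hy : 0 ≤ y) (hb : b < asympDisp β y) :
    Tendsto (fun n : ℕ => P {ω | (X ⌊y * n⌋₊ n ω : ℝ) < b * n}) atTop (𝓝 0) := by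
  have happrox : ∀ m n, Tendsto (fun N => approxMean β N m n) atTop (𝓝 (limMean β m n)) := by
    intro m n
    refine tendsto_atTop_ciSup (monotone_nat_of_le_succ fun N => ?_) (bddAbove_approxMean hβ m n)
    rw [approxMean_eq_integral hG, approxMean_eq_integral hG]
    have hi : ∀ N, Integrable (fun ω => (disp (G N ω) m (2 ^ N * n) : ℝ)) P := fun N =>
      (hG N).integrable_comp_of_integrable (integrable_disp (memLp_stepLaw β N) m (2 ^ N * n))
    exact integral_mono (hi N) (hi (N + 1)) fun ω => Nat.cast_le.2 (hmono ω N m n)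
  refine ENNReal.tendsto_nhds_zero.2 fun ε hε => ?_
  obtain ⟨c, hc, hcε⟩ : ∃ c : ℝ, 0 < c ∧ ENNReal.ofReal c ≤ ε := by
    rcases eq_or_ne ε ∞ with rfl | h
    · exact ⟨1, one_pos, le_top⟩
    · exact ⟨ε.toReal, ENNReal.toReal_pos hε.ne' h, ENNReal.ofReal_toReal_le⟩
  have hd : 0 < asympDisp β y - b := sub_pos.2 hb
  have hη : 0 < c * (asympDisp β y - b) / 3 := by positivity
  filter_upwards [eventually_lower_tail_le hβ hy hb hη, eventually_gt_atTop 0] with n hn hn0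
  have hn' : (0 : ℝ) < n := by exact_mod_cast hn0
  refine le_trans ?_ hcε
  refine measure_le_of_ae_eventually_mem
    (A := fun N => G N ⁻¹' {g | (disp g ⌊y * n⌋₊ (2 ^ N * n) : ℝ) < b * n}) ?_ ?_
  · filter_upwards [hX] with ω hω hS
    filter_upwards [hω ⌊y * n⌋₊ n] with N hN
    have hS' : (X ⌊y * n⌋₊ n ω : ℝ) < b * n := hS
    rw [hN] at hS'
    exact hS'
  · have hlow := asympDisp_mul_le hβ (y := y) (m := ⌊y * n⌋₊) hn0.ne'
      (Nat.floor_le (by positivity))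
    filter_upwards [(happrox ⌊y * n⌋₊ n).eventually_const_lt
      (show (asympDisp β y - c * (asympDisp β y - b) / 3) * n < limMean β ⌊y * n⌋₊ n by
        nlinarith [mul_pos hη hn'])] with N hN
    have h := measure_preimage_le (hG N) ((measurable_of_countable (fun n : ℕ => (n : ℝ))).comp
      (measurable_disp_field _ _) measurableSet_Iio) (hn N hN.le)
    rwa [show 3 * (c * (asympDisp β y - b) / 3) / (asympDisp β y - b) = c by field_simp] at h

end LawOfLargeNumbers

/-! ### Poisson commands and their discretization -/

lemma epochCount_ne_zero {S : Set ℝ} {a b : ℝ} :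
    epochCount S a b ≠ 0 ↔ ∃ τ ∈ S, a ≤ τ ∧ τ < b := by
  rw [epochCount, Set.encard_ne_zero]
  exact ⟨fun ⟨τ, h, h'⟩ => ⟨τ, h, h'⟩, fun ⟨τ, h, h'⟩ => ⟨τ, h, h'⟩⟩

lemma epochCount_eq_zero {S : Set ℝ} {a b : ℝ} :
    epochCount S a b = 0 ↔ Disjoint S (Ico a b) := by
  rw [epochCount, Set.encard_eq_zero, Set.disjoint_iff_inter_eq_empty]

/-- The jump attempted by particle `-p.1` in the time interval `[p.2 / 2ᴺ, (p.2 + 1) / 2ᴺ)` in the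
approximation of mesh `2⁻ᴺ`. If several jumps are commanded in that interval, only the largest one
is kept, and jumps of more than `N` steps are ignored. -/
def cellJump (D : ℤ → ℕ+ → Set ℝ) (N : ℕ) (p : ℕ × ℕ) : ℕ :=
  largestJump N fun k => epochCount (D (-p.1) k) (p.2 / 2 ^ N) ((p.2 + 1) / 2 ^ N)

lemma cellJump_le_max (D : ℤ → ℕ+ → Set ℝ) (N i l : ℕ) :
    cellJump D N (i, l) ≤
      max (cellJump D (N + 1) (i, 2 * l)) (cellJump D (N + 1) (i, 2 * l + 1)) := by
  refine largestJump_le fun k hk hc => ?_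
  obtain ⟨τ, hτ, h1, h2⟩ := epochCount_ne_zero.1 hc
  have e0 : ((l : ℝ) / 2 ^ N) = (2 * l : ℕ) / 2 ^ (N + 1) := by
    rw [pow_succ]; push_cast; field_simp
  have e1 : (((2 * l : ℕ) : ℝ) + 1) / 2 ^ (N + 1) = ((2 * l + 1 : ℕ) : ℝ) / 2 ^ (N + 1) := by
    push_cast; rfl
  have e2 : ((l : ℝ) + 1) / 2 ^ N = (((2 * l + 1 : ℕ) : ℝ) + 1) / 2 ^ (N + 1) := by
    rw [pow_succ]; push_cast; field_simp; ring
  rcases lt_or_ge τ (((2 * l : ℕ) + 1) / 2 ^ (N + 1)) with h | h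
  · exact le_max_of_le_left (le_largestJump (hk.trans N.lt_succ_self)
      (epochCount_ne_zero.2 ⟨τ, hτ, e0 ▸ h1, h⟩))
  · exact le_max_of_le_right (le_largestJump (hk.trans N.lt_succ_self)
      (epochCount_ne_zero.2 ⟨τ, hτ, e1 ▸ h, e2 ▸ h2⟩))

lemma disp_cellJump_le_succ (D : ℤ → ℕ+ → Set ℝ) (N m n : ℕ) :
    disp (cellJump D N) m (2 ^ N * n) ≤ disp (cellJump D (N + 1)) m (2 ^ (N + 1) * n) := by
  have h := disp_le_disp_two_mul (cellJump_le_max D N) m (2 ^ N * n)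
  rwa [← mul_assoc, ← pow_succ'] at h

section Poisson

lemma measurable_epochSigma {Ω : Type*} (S : Ω → Set ℝ) (a b : ℝ) :
    Measurable[epochSigma S] fun ω => epochCount (S ω) a b :=
  Measurable.mono (comap_measurable _) (le_iSup₂_of_le a b le_rfl) le_rfl

variable {Ω : Type*} [MeasurableSpace Ω] {P : Measure Ω}

lemma iIndepFun_of_iIndep {ι : Type*} {m : ι → MeasurableSpace Ω} (hm : iIndep m P)
    {𝓧 : ι → Type*} [∀ i, MeasurableSpace (𝓧 i)] {X : ∀ i, Ω → 𝓧 i}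
    (hX : ∀ i, Measurable[m i] (X i)) : iIndepFun X P :=
  iIndep_of_iIndep_of_le hm fun i => (hX i).comap_le

/-- If a doubly indexed field has independent entries, whose laws depend on the second index only,
then applying the same function to all its rows produces an i.i.d. sequence. -/
lemma map_rows_eq_infinitePi {ι κ 𝓧 𝓨 : Type*} [MeasurableSpace 𝓧] [MeasurableSpace 𝓨]
    (law : κ → Measure 𝓧) [∀ k, IsProbabilityMeasure (law k)] {C : Ω → ι × κ → 𝓧}
    (hCm : Measurable C) (hC : P.map C = Measure.infinitePi fun q : ι × κ => law q.2)
    {φ : (κ → 𝓧) → 𝓨} (hφ : Measurable φ) :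
    P.map (fun ω i => φ fun k => C ω (i, k))
      = Measure.infinitePi fun _ : ι => (Measure.infinitePi law).map φ := by
  have hm : Measurable fun (c : ι → κ → 𝓧) p => φ (c p) :=
    measurable_pi_lambda _ fun p => hφ.comp (measurable_pi_apply p)
  rw [← Measure.infinitePi_map_pi (fun _ : ι => Measure.infinitePi law) (f := fun _ => φ)
    fun _ => hφ, ← Measure.infinitePi_map_curry (ι := ι) fun _ k => law k, ← hC,
    Measure.map_map (MeasurableEquiv.measurable _) hCm,
    Measure.map_map hm ((MeasurableEquiv.measurable _).comp hCm)]
  rfl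

lemma IsPoissonPointProcess.epochSigma_le {S : Ω → Set ℝ} {r : ℝ≥0}
    (hS : IsPoissonPointProcess P S r) : epochSigma S ≤ ‹MeasurableSpace Ω› :=
  iSup₂_le fun a b => (hS.measurable_count a b).comap_le

variable {β : ℕ+ → ℝ≥0} {D : ℤ → ℕ+ → Ω → Set ℝ}

/-- The numbers of commands given to different particles, for different jump lengths and in
different time intervals of a subdivision are independent. -/
lemma IsJumpCommands.iIndepFun_count [IsProbabilityMeasure P] (hD : IsJumpCommands P β D) (N : ℕ) :
    iIndepFun (fun (q : (ℕ × ℕ) × ℕ+) ω =>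
      epochCount (D (-q.1.1) q.2 ω) (q.1.2 / 2 ^ N) ((q.1.2 + 1) / 2 ^ N)) P := by
  have hinj : Function.Injective fun q : ℕ × ℕ+ => (-(q.1 : ℤ), q.2) := by
    rintro ⟨i, k⟩ ⟨i', k'⟩ h
    simpa using h
  have hσ : iIndep (fun q : ℕ × ℕ+ => epochSigma (D (-q.1) q.2)) P :=
    iIndep.precomp (m := fun p : ℤ × ℕ+ => epochSigma (D p.1 p.2))
      (g := fun q : ℕ × ℕ+ => (-(q.1 : ℤ), q.2)) hinj hD.indep
  have h1 : iIndepFun (fun (q : ℕ × ℕ+) ω (l : ℕ) =>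
      epochCount (D (-q.1) q.2 ω) (l / 2 ^ N) ((l + 1) / 2 ^ N)) P :=
    iIndepFun_of_iIndep hσ fun q =>
      @measurable_pi_lambda _ _ _ (_) _ _ fun l => measurable_epochSigma (D (-q.1) q.2) _ _
  have h2 : ∀ q : ℕ × ℕ+, iIndepFun (fun (l : ℕ) ω =>
      epochCount (D (-q.1) q.2 ω) (l / 2 ^ N) ((l + 1) / 2 ^ N)) P := fun q => by
    have h := (hD.poisson (-(q.1 : ℤ)) q.2).indep_count (fun n => (n : ℝ) / 2 ^ N) (by simp)
      fun a b hab => div_le_div_of_nonneg_right (Nat.cast_le.2 hab) (by positivity)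
    simpa only [Nat.cast_add, Nat.cast_one] using h
  have h := iIndepFun_uncurry' (fun (q : ℕ × ℕ+) (l : ℕ) =>
    (hD.poisson (-q.1) q.2).measurable_count (l / 2 ^ N) ((l + 1) / 2 ^ N)) h1 h2
  exact h.precomp (g := fun q : (ℕ × ℕ) × ℕ+ => ((q.1.1, q.2), q.1.2))
    (by rintro ⟨⟨i, l⟩, k⟩ ⟨⟨i', l'⟩, k'⟩ h; simp only [Prod.mk.injEq] at h ⊢; tauto)

lemma IsJumpCommands.hasLaw_count_cell (hD : IsJumpCommands P β D) (i : ℤ) (k : ℕ+) (N l : ℕ) :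
    HasLaw (fun ω => epochCount (D i k ω) (l / 2 ^ N) ((l + 1) / 2 ^ N))
      (countLaw (β k * ((2 : ℝ≥0) ^ N)⁻¹)) P := by
  have h := (hD.poisson i k).hasLaw_count (l / 2 ^ N) ((2 ^ N)⁻¹)
  have e : ((((l : ℝ≥0) / 2 ^ N : ℝ≥0) : ℝ) + (((2 : ℝ≥0) ^ N)⁻¹ : ℝ≥0))
      = ((l : ℝ) + 1) / 2 ^ N := by
    push_cast; rw [add_div, one_div]
  rw [e] at h
  simpa [countLaw] using h

lemma measurable_cellJump (hD : IsJumpCommands P β D) (N : ℕ) :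
    Measurable fun ω => cellJump (fun i k => D i k ω) N :=
  measurable_pi_lambda _ fun _ => (measurable_largestJump N).comp
    (measurable_pi_lambda _ fun k => (hD.poisson _ k).measurable_count _ _)

lemma IsJumpCommands.measurable_counts (hD : IsJumpCommands P β D) (N : ℕ) :
    Measurable fun ω (q : (ℕ × ℕ) × ℕ+) =>
      epochCount (D (-q.1.1) q.2 ω) (q.1.2 / 2 ^ N) ((q.1.2 + 1) / 2 ^ N) :=
  measurable_pi_lambda _ fun q => (hD.poisson (-q.1.1) q.2).measurable_count _ _

lemma IsJumpCommands.hasLaw_counts [IsProbabilityMeasure P] (hD : IsJumpCommands P β D) (N : ℕ) :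
    HasLaw (fun ω (q : (ℕ × ℕ) × ℕ+) =>
      epochCount (D (-q.1.1) q.2 ω) (q.1.2 / 2 ^ N) ((q.1.2 + 1) / 2 ^ N))
      (Measure.infinitePi fun q : (ℕ × ℕ) × ℕ+ => countLaw (β q.2 * ((2 : ℝ≥0) ^ N)⁻¹)) P := by
  have h : ∀ q : (ℕ × ℕ) × ℕ+, HasLaw (fun ω =>
      epochCount (D (-q.1.1) q.2 ω) (q.1.2 / 2 ^ N) ((q.1.2 + 1) / 2 ^ N))
      (countLaw (β q.2 * ((2 : ℝ≥0) ^ N)⁻¹)) P := fun q =>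
    hD.hasLaw_count_cell (-q.1.1) q.2 N q.1.2
  exact (hD.iIndepFun_count N).hasLaw_infinitePi h (hD.measurable_counts N).aemeasurable

/-- In the approximation of mesh `2⁻ᴺ` the attempted jumps are independent and have a law which
depends only on the rates. -/
lemma IsJumpCommands.measurePreserving_cellJump [IsProbabilityMeasure P]
    (hD : IsJumpCommands P β D) (N : ℕ) :
    MeasurePreserving (fun ω => cellJump (fun i k => D i k ω) N) P (fieldLaw (stepLaw β N)) := by
  refine ⟨measurable_cellJump hD N, ?_⟩
  exact map_rows_eq_infinitePi (fun k => countLaw (β k * ((2 : ℝ≥0) ^ N)⁻¹))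
    (hD.measurable_counts N) (hD.hasLaw_counts N).map_eq (measurable_largestJump N)

/-! ### Almost sure properties of the commands -/

lemma IsPoissonPointProcess.measure_count_ne_zero_le {S : Ω → Set ℝ} {r : ℝ≥0}
    (hS : IsPoissonPointProcess P S r) (s h : ℝ≥0) :
    P {ω | epochCount (S ω) s (s + h) ≠ 0} ≤ r * h := by
  rw [(hS.hasLaw_count s h).measure_eq (p := fun n => n ≠ 0) .of_discrete]
  change countLaw (r * h) {0}ᶜ ≤ _
  rw [← ofReal_measureReal, probReal_compl_eq_one_sub (measurableSet_singleton _),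
    countLaw_real_singleton_zero, ← ENNReal.coe_mul, ← ENNReal.ofReal_coe_nnreal]
  refine ENNReal.ofReal_le_ofReal ?_
  linarith [Real.add_one_le_exp (-((r * h : ℝ≥0) : ℝ))]

lemma IsPoissonPointProcess.ae_count_ne_top {S : Ω → Set ℝ} {r : ℝ≥0}
    (hS : IsPoissonPointProcess P S r) (s h : ℝ≥0) :
    ∀ᵐ ω ∂P, epochCount (S ω) s (s + h) ≠ ⊤ := by
  rw [ae_iff]
  simp only [not_not]
  rw [(hS.hasLaw_count s h).measure_eq (p := fun n => n = ⊤) .of_discrete]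
  rw [Measure.map_apply (measurable_of_countable _) .of_discrete]
  have : (fun n : ℕ => (n : ℕ∞)) ⁻¹' {n | n = ⊤} = ∅ := by ext n; simp
  rw [this, measure_empty]

/-- A Poisson point process does not charge a fixed time. -/
lemma IsPoissonPointProcess.ae_notMem {S : Ω → Set ℝ} {r : ℝ≥0}
    (hS : IsPoissonPointProcess P S r) (c : ℝ≥0) : ∀ᵐ ω ∂P, (c : ℝ) ∉ S ω := by
  rw [ae_iff]
  simp only [not_not]
  have h : ∀ n : ℕ, P {ω | (c : ℝ) ∈ S ω} ≤ r * ((n : ℝ≥0) + 1)⁻¹ := fun n => by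
    refine (measure_mono fun ω hω => ?_).trans
      ((hS.measure_count_ne_zero_le c ((n : ℝ≥0) + 1)⁻¹).trans_eq ?_)
    · refine epochCount_ne_zero.2 ⟨c, hω, le_rfl, ?_⟩
      have : (0 : ℝ) < (((n : ℝ≥0) + 1)⁻¹ : ℝ≥0) := by positivity
      linarith
    · rfl
  have hlim : Tendsto (fun n : ℕ => (r : ℝ≥0∞) * (((n : ℝ≥0) + 1)⁻¹ : ℝ≥0)) atTop (𝓝 (r * 0)) := by
    refine ENNReal.Tendsto.const_mul ?_ (Or.inr ENNReal.coe_ne_top)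
    rw [← ENNReal.coe_zero, ENNReal.tendsto_coe]
    have := tendsto_one_div_add_atTop_nhds_zero_nat (𝕜 := ℝ≥0)
    simpa only [one_div] using this
  rw [mul_zero] at hlim
  exact le_antisymm (ge_of_tendsto' hlim fun n => h n) zero_le

lemma IsJumpCommands.ae_notMem_dyadic (hD : IsJumpCommands P β D) :
    ∀ᵐ ω ∂P, ∀ (i : ℤ) (k : ℕ+) (N l : ℕ), (l / 2 ^ N : ℝ) ∉ D i k ω := by
  simp only [ae_all_iff]
  intro i k N l
  have h := (hD.poisson i k).ae_notMem (l / 2 ^ N)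
  simpa using h

lemma IsJumpCommands.ae_finite_epochs (hβ : Summable fun k => (β k : ℝ))
    (hD : IsJumpCommands P β D) :
    ∀ᵐ ω ∂P, ∀ (i : ℤ) (T : ℕ), {q : ℕ+ × ℝ | q.2 ∈ D i q.1 ω ∧ q.2 < T}.Finite := by
  simp only [ae_all_iff]
  intro i T
  have hsum : ∑' k, P {ω | epochCount (D i k ω) (0 : ℝ≥0) ((0 : ℝ≥0) + (T : ℝ≥0)) ≠ 0} ≠ ∞ := by
    refine ne_top_of_le_ne_top ?_
      (ENNReal.tsum_le_tsum fun k => (hD.poisson i k).measure_count_ne_zero_le 0 T)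
    rw [ENNReal.tsum_mul_right]
    exact ENNReal.mul_ne_top (ENNReal.tsum_coe_ne_top_iff_summable.2
      (NNReal.summable_coe.1 hβ)) ENNReal.coe_ne_top
  have h2 : ∀ᵐ ω ∂P, ∀ k, epochCount (D i k ω) (0 : ℝ≥0) ((0 : ℝ≥0) + (T : ℝ≥0)) ≠ ⊤ :=
    ae_all_iff.2 fun k => (hD.poisson i k).ae_count_ne_top 0 T
  filter_upwards [ae_finite_setOfPred_mem hsum, h2] with ω h1 h2
  refine (h1.biUnion fun k _ => (Set.finite_singleton k).prod
    (Set.encard_ne_top_iff.1 (h2 k))).subset ?_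
  rintro ⟨k, τ⟩ ⟨hτ, hτT⟩
  have h0 : (0 : ℝ) ≤ τ := (hD.poisson i k).subset_Ici ω hτ
  have hmem : τ ∈ D i k ω ∩ Ico ((0 : ℝ≥0) : ℝ) (((0 : ℝ≥0) : ℝ) + ((T : ℝ≥0) : ℝ)) := by
    refine ⟨hτ, ?_, ?_⟩
    · simpa using h0
    · simpa using hτT
  refine Set.mem_biUnion (x := k) ?_ ⟨rfl, hmem⟩
  exact epochCount_ne_zero.2 ⟨τ, hτ, hmem.2⟩

/-- In a short time interval there are almost surely particles arbitrarily far to the right which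
receive no command, so that no influence can come from infinity. -/
lemma IsJumpCommands.ae_exists_quiet [IsProbabilityMeasure P] (hD : IsJumpCommands P β D)
    (s h : ℝ≥0) (hh : (∑' k, (β k : ℝ≥0∞)) * h ≤ 2⁻¹) (j : ℤ) :
    ∀ᵐ ω ∂P, ∃ i, j ≤ i ∧ ∀ k, Disjoint (D i k ω) (Ico (s : ℝ) (s + h)) := by
  set A : ℤ → Set Ω := fun i => ⋃ k, {ω | epochCount (D i k ω) s (s + h) ≠ 0} with hA
  have hAm : ∀ (S : Set (ℤ × ℕ+)) (i : ℤ), (∀ k, (i, k) ∈ S) →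
      MeasurableSet[⨆ q ∈ S, epochSigma (D q.1 q.2)] (A i) := fun S i hi => by
    refine MeasurableSet.iUnion fun k => ?_
    have hle : epochSigma (D i k) ≤ ⨆ q ∈ S, epochSigma (D q.1 q.2) :=
      le_iSup₂_of_le (f := fun (q : ℤ × ℕ+) (_ : q ∈ S) => epochSigma (D q.1 q.2)) (i, k) (hi k)
        le_rfl
    exact hle _ (measurable_epochSigma (D i k) s (s + h) (MeasurableSet.of_discrete (s := {0}ᶜ)))
  have hA1 : ∀ i, P (A i) ≤ 2⁻¹ := fun i =>
    (measure_iUnion_le _).trans ((ENNReal.tsum_le_tsum fun k =>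
      (hD.poisson i k).measure_count_ne_zero_le s h).trans (by rwa [ENNReal.tsum_mul_right]))
  have hA2 : ∀ n : ℕ, P (⋂ a ∈ Finset.range n, A (j + a)) ≤ 2⁻¹ ^ n := fun n => by
    induction n with
    | zero => simp
    | succ n ih =>
      have hind := indep_iSup_of_disjoint
        (fun q : ℤ × ℕ+ => (hD.poisson q.1 q.2).epochSigma_le) hD.indep
        (S := {q | q.1 = j + n}) (T := {q | q.1 < j + n}) (by
          rw [Set.disjoint_left]; rintro q h1 h2
          exact absurd h1 (ne_of_lt h2))
      have h := (Indep_iff _ _ _).1 hind (A (j + n)) (⋂ a ∈ Finset.range n, A (j + a))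
        (hAm _ _ fun _ => rfl) (Finset.measurableSet_biInter _ fun a ha => hAm _ _ fun _ => by
          have := Finset.mem_range.1 ha
          show j + (a : ℤ) < j + n
          omega)
      rw [Finset.range_add_one, Finset.set_biInter_insert, h, pow_succ, mul_comm]
      exact mul_le_mul' ih (hA1 _)
  rw [ae_iff]
  refine le_antisymm (ge_of_tendsto' (ENNReal.tendsto_pow_atTop_nhds_zero_of_lt_one
    (r := 2⁻¹) (by simp)) fun n => le_trans (measure_mono fun ω hω => ?_) (hA2 n)) zero_le
  simp only [Set.mem_ofPred_eq, not_exists, not_and, not_forall] at hω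
  refine Set.mem_iInter₂.2 fun a _ => ?_
  obtain ⟨k, hk⟩ := hω (j + a) (by omega)
  refine Set.mem_iUnion.2 ⟨k, ?_⟩
  rw [← epochCount_eq_zero] at hk
  exact hk

end Poisson

/-! ### Exactness of the discretization -/

/-- The properties of a realization of the jump commands that hold almost surely and are used in
the deterministic analysis of the jump rule: local finiteness, absence of epochs at the dyadic
times, and existence of particles far to the right which rest during a given short time
interval. -/
structure RegularCommands (D : ℤ → ℕ+ → Set ℝ) : Prop where
  finite : ∀ (i : ℤ) (T : ℕ), {q : ℕ+ × ℝ | q.2 ∈ D i q.1 ∧ q.2 < T}.Finite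
  notMem_dyadic : ∀ (i : ℤ) (k : ℕ+) (N l : ℕ), (l / 2 ^ N : ℝ) ∉ D i k
  quiet : ∃ δ : ℝ, 0 < δ ∧ ∀ (w : ℕ) (j : ℤ), ∃ i, j ≤ i ∧
    ∀ k, Disjoint (D i k) (Ico (w * δ) (w * δ + 2 * δ))

section JumpRule

variable {D : ℤ → ℕ+ → Set ℝ} {σ : ℤ → ℝ → WithTop ℤ}

lemma RegularCommands.finite_times (hD : RegularCommands D) (i : ℤ) (c u : ℝ) :
    {τ | ∃ k, τ ∈ D i k ∧ c < τ ∧ τ ≤ u}.Finite := by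
  obtain ⟨T, hT⟩ := exists_nat_gt u
  refine ((hD.finite i T).image Prod.snd).subset ?_
  rintro τ ⟨k, hk, _, hu⟩
  exact ⟨(k, τ), ⟨hk, hu.trans_lt hT⟩, rfl⟩

lemma ObeysJumpRule.eq_of_forall_notMem (hσ : ObeysJumpRule D σ) {i : ℤ} {s t : ℝ} (hs : 0 ≤ s)
    (hst : s ≤ t) (h : ∀ k, ∀ τ ∈ D i k, s < τ → ¬ τ ≤ t) : σ i t = σ i s :=
  hσ.const i s t hs hst fun k => Set.disjoint_left.2 fun τ hτ h' => h k τ hτ h'.1 h'.2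

/-- At an epoch `τ` the left limits in the jump rule are attained at some time in `(c, τ)`. -/
lemma ObeysJumpRule.exists_jump (hσ : ObeysJumpRule D σ) {i : ℤ} {k : ℕ+} {c τ : ℝ} (hc : 0 ≤ c)
    (hcτ : c < τ) (hτ : τ ∈ D i k) :
    ∃ u, c < u ∧ u < τ ∧ σ i τ = min (σ i u + ((k : ℤ) : WithTop ℤ)) (σ (i + 1) u - 1) := by
  obtain ⟨a, b, ha, hb, h⟩ := hσ.jump i k τ (hc.trans_lt hcτ) hτ
  have hI : ∀ᶠ u in 𝓝[<] τ, u ∈ Ioo c τ := Ioo_mem_nhdsLT hcτ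
  obtain ⟨u, hua, hub, hu⟩ := (ha.and (hb.and hI)).exists
  exact ⟨u, hu.1, hu.2, by rw [hua, hub, h]⟩

/-- A particle at infinity stays there as long as its right neighbour does. -/
lemma ObeysJumpRule.eq_top_of_right (hσ : ObeysJumpRule D σ) (hD : RegularCommands D) {i : ℤ}
    {c c' : ℝ} (hc : 0 ≤ c) (hi : σ i c = ⊤) (hright : ∀ u ∈ Icc c c', σ (i + 1) u = ⊤) :
    ∀ u ∈ Icc c c', σ i u = ⊤ := by
  have key : ∀ n : ℕ, ∀ u ∈ Icc c c', {τ | ∃ k, τ ∈ D i k ∧ c < τ ∧ τ ≤ u}.ncard = n →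
      σ i u = ⊤ := by
    intro n
    induction n using Nat.strong_induction_on with
    | _ n ih =>
      intro u hu hn
      have hfin := hD.finite_times i c u
      rcases Set.eq_empty_or_nonempty {τ | ∃ k, τ ∈ D i k ∧ c < τ ∧ τ ≤ u} with h | h
      · rw [hσ.eq_of_forall_notMem hc hu.1 fun k τ hτ h1 h2 => ?_, hi]
        have : τ ∈ {τ | ∃ k, τ ∈ D i k ∧ c < τ ∧ τ ≤ u} := ⟨k, hτ, h1, h2⟩
        rwa [h] at this
      · obtain ⟨τ, ⟨k, hτ, hcτ, hτu⟩, hmax⟩ := Set.exists_max_image _ id hfin h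
        have h1 : σ i u = σ i τ := hσ.eq_of_forall_notMem (hc.trans hcτ.le) hτu
          fun k' τ' hτ' h2 h3 => absurd (hmax τ' ⟨k', hτ', hcτ.trans h2, h3⟩) (not_le.2 h2)
        obtain ⟨v, hcv, hvτ, hv⟩ := hσ.exists_jump hc hcτ hτ
        have hv' : v ∈ Icc c c' := ⟨hcv.le, (hvτ.le.trans hτu).trans hu.2⟩
        have hlt : {τ | ∃ k, τ ∈ D i k ∧ c < τ ∧ τ ≤ v}.ncard < n := by
          rw [← hn]
          refine Set.ncard_lt_ncard ?_ hfin
          refine (Set.ssubset_iff_of_subset ?_).2 ⟨τ, ⟨k, hτ, hcτ, hτu⟩, ?_⟩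
          · rintro τ' ⟨k', h4, h5, h6⟩
            exact ⟨k', h4, h5, h6.trans (hvτ.le.trans hτu)⟩
          · rintro ⟨_, _, _, h6⟩
            exact absurd h6 (not_le.2 hvτ)
        rw [h1, hv, ih _ hlt v hv' rfl, hright v hv']
        rfl
  exact fun u hu => key _ u hu rfl

/-- The particles that start at infinity stay there. -/
lemma ObeysJumpRule.eq_top (hσ : ObeysJumpRule D σ) (hD : RegularCommands D)
    (h0 : ∀ i, σ i 0 = stepConfig i) {i : ℤ} (hi : 0 < i) {t : ℝ} (ht : 0 ≤ t) : σ i t = ⊤ := by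
  obtain ⟨δ, hδ, hq⟩ := hD.quiet
  have key : ∀ w : ℕ, ∀ i : ℤ, 0 < i → ∀ u ∈ Icc 0 (w * δ), σ i u = ⊤ := by
    intro w
    induction w with
    | zero =>
      intro i hi u hu
      have : u = 0 := le_antisymm (by simpa using hu.2) hu.1
      rw [this, h0, stepConfig, if_pos hi]
    | succ w ih =>
      have hw : (0 : ℝ) ≤ w * δ := by positivity
      have hstep : ∀ i : ℤ, 0 < i → ∀ u ∈ Icc (w * δ) ((w + 1) * δ), σ i u = ⊤ := by
        intro i hi
        obtain ⟨i', hii', hquiet⟩ := hq w i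
        have hi' : ∀ u ∈ Icc (w * δ) ((w + 1) * δ), σ i' u = ⊤ := by
          intro u hu
          rw [hσ.eq_of_forall_notMem hw hu.1 fun k τ hτ h1 h2 =>
            Set.disjoint_left.1 (hquiet k) hτ ⟨h1.le, by have := hu.2; linarith⟩]
          exact ih i' (hi.trans_le hii') _ ⟨hw, le_rfl⟩
        obtain ⟨n, rfl⟩ := Int.le.dest hii'
        clear hii' hquiet
        induction n with
        | zero => simpa using hi'
        | succ n ihn =>
          refine ihn (hσ.eq_top_of_right hD hw (ih _ (by omega) _ ⟨hw, le_rfl⟩) ?_)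
          have e : i + (n : ℤ) + 1 = i + ((n + 1 : ℕ) : ℤ) := by push_cast; ring
          rwa [e]
      intro i hi u hu
      rcases le_total u (w * δ) with h | h
      · exact ih i hi u ⟨hu.1, h⟩
      · exact hstep i hi u ⟨h, by have := hu.2; push_cast at this; exact this⟩
  obtain ⟨w, hw⟩ := exists_nat_ge (t / δ)
  exact key w i hi t ⟨ht, (div_le_iff₀ hδ).1 hw⟩

/-- If all the commands to particle `i` in `(c, c']` come at the same time `τ`, before which its
right neighbour does not move, then particle `i` performs a single jump. -/
lemma ObeysJumpRule.eq_min_of_single (hσ : ObeysJumpRule D σ) {i : ℤ} {k : ℕ+} {c c' τ : ℝ}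
    (hc : 0 ≤ c) (hcτ : c < τ) (hτc' : τ ≤ c') (hτ : τ ∈ D i k)
    (hi : ∀ k, ∀ τ' ∈ D i k, c < τ' → τ' ≤ c' → τ' = τ)
    (hright : ∀ u, c ≤ u → u < τ → σ (i + 1) u = σ (i + 1) c) :
    σ i c' = min (σ i c + ((k : ℤ) : WithTop ℤ)) (σ (i + 1) c - 1) := by
  have h1 : σ i c' = σ i τ := hσ.eq_of_forall_notMem (hc.trans hcτ.le) hτc'
    fun k' τ' hτ' h2 h3 => h2.ne' (hi k' τ' hτ' (hcτ.trans h2) h3)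
  obtain ⟨u, hcu, huτ, hu⟩ := hσ.exists_jump hc hcτ hτ
  have h2 : σ i u = σ i c := hσ.eq_of_forall_notMem hc hcu.le fun k' τ' hτ' h2 h3 => by
    have := hi k' τ' hτ' h2 (h3.trans (huτ.le.trans hτc'))
    linarith
  rw [h1, hu, h2, hright u hcu.le huτ]

lemma RegularCommands.eventually_separated (hD : RegularCommands D) (m T : ℕ) :
    ∀ᶠ N : ℕ in atTop, (∀ j ≤ m, ∀ k, ∀ τ ∈ D (-(j : ℤ)) k, τ < T → (k : ℕ) ≤ N) ∧
      ∀ j ≤ m, ∀ j' ≤ m, ∀ k k', ∀ τ ∈ D (-(j : ℤ)) k, ∀ τ' ∈ D (-(j' : ℤ)) k',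
        τ < T → τ' < T → |τ - τ'| < 1 / 2 ^ N → τ = τ' := by
  set F : Set (ℕ+ × ℝ) := ⋃ j ∈ Set.Iic m, {q : ℕ+ × ℝ | q.2 ∈ D (-(j : ℤ)) q.1 ∧ q.2 < T}
  have hF : F.Finite := (Set.finite_Iic m).biUnion fun j _ => hD.finite _ T
  have hmem : ∀ j ≤ m, ∀ k, ∀ τ ∈ D (-(j : ℤ)) k, τ < T → (k, τ) ∈ F := fun j hj k τ hτ hT =>
    Set.mem_biUnion (x := j) hj ⟨hτ, hT⟩
  have h1 : ∀ᶠ N : ℕ in atTop, ∀ q ∈ F, (q.1 : ℕ) ≤ N :=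
    (Set.Finite.eventually_all hF).2 fun q _ => eventually_ge_atTop _
  have h2 : ∀ᶠ N : ℕ in atTop, ∀ q ∈ F, ∀ q' ∈ F, |q.2 - q'.2| < 1 / 2 ^ N → q.2 = q'.2 := by
    refine (Set.Finite.eventually_all hF).2 fun q _ =>
      (Set.Finite.eventually_all hF).2 fun q' _ => ?_
    by_cases h : q.2 = q'.2
    · exact Eventually.of_forall fun _ _ => h
    · have hlim : Tendsto (fun N : ℕ => (1 / 2 : ℝ) ^ N) atTop (𝓝 0) :=
        tendsto_pow_atTop_nhds_zero_of_lt_one (by norm_num) (by norm_num)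
      filter_upwards [hlim.eventually_lt_const (abs_pos.2 (sub_ne_zero.2 h))] with N hN hN'
      rw [one_div, inv_pow, ← one_div] at hN
      exact absurd hN' (not_lt.2 hN.le)
  filter_upwards [h1, h2] with N h1 h2
  exact ⟨fun j hj k τ hτ hT => h1 _ (hmem j hj k τ hτ hT),
    fun j hj j' hj' k k' τ hτ τ' hτ' hT hT' =>
      h2 _ (hmem j hj k τ hτ hT) _ (hmem j' hj' k' τ' hτ' hT')⟩

/-- Once the mesh separates the epochs of the particles `0, …, -m` before time `T`, the discrete
dynamics reproduces their motion at the multiples of the mesh. -/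
lemma ObeysJumpRule.eventually_eq_disp (hσ : ObeysJumpRule D σ) (hD : RegularCommands D)
    (h0 : ∀ i, σ i 0 = stepConfig i) (m T : ℕ) :
    ∀ᶠ N : ℕ in atTop, ∀ l ≤ 2 ^ N * T, ∀ j ≤ m,
      σ (-(j : ℤ)) (l / 2 ^ N) = (((disp (cellJump D N) j l : ℤ) - j : ℤ) : WithTop ℤ) := by
  filter_upwards [hD.eventually_separated m T] with N ⟨hcap, hsep⟩ l
  induction l with
  | zero =>
    intro _ j _
    simp [h0, stepConfig]
  | succ l ih =>
    intro hl j hj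
    have ih := ih (by omega)
    have h2N : (0 : ℝ) < 2 ^ N := by positivity
    set c : ℝ := l / 2 ^ N with hc
    set c' : ℝ := ((l + 1 : ℕ) : ℝ) / 2 ^ N with hc'
    have hc0 : 0 ≤ c := by positivity
    have hcc' : c' = c + 1 / 2 ^ N := by rw [hc, hc']; push_cast; rw [add_div]
    have hlen : (0 : ℝ) < 1 / 2 ^ N := by positivity
    have hc'T : c' ≤ T := by
      rw [hc', div_le_iff₀ h2N, mul_comm]
      exact_mod_cast hl
    have hltc' : ∀ i k, ∀ τ ∈ D i k, τ ≤ c' → τ < c' := fun i k τ hτ h =>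
      lt_of_le_of_ne h fun h' => hD.notMem_dyadic i k N (l + 1) (by rw [h'] at hτ; exact hτ)
    have hcell : ∀ k, epochCount (D (-(j : ℤ)) k) (l / 2 ^ N) ((l + 1) / 2 ^ N) ≠ 0 ↔
        ∃ τ ∈ D (-(j : ℤ)) k, c < τ ∧ τ ≤ c' := fun k => by
      rw [epochCount_ne_zero]
      constructor
      · rintro ⟨τ, hτ, h1, h2⟩
        refine ⟨τ, hτ, lt_of_le_of_ne h1 fun h' => hD.notMem_dyadic _ k N l (h' ▸ hτ), ?_⟩
        rw [hc']; push_cast; exact h2.le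
      · rintro ⟨τ, hτ, h1, h2⟩
        refine ⟨τ, hτ, h1.le, ?_⟩
        have := hltc' _ k τ hτ h2
        rw [hc'] at this; push_cast at this; exact this
    by_cases hex : ∃ k, ∃ τ ∈ D (-(j : ℤ)) k, c < τ ∧ τ ≤ c'
    · obtain ⟨k, τ, hτ, hcτ, hτc'⟩ := hex
      -- Several jump lengths may be commanded at the single epoch of the cell; the jump rule for
      -- the largest one determines the new position.
      have hkN : (k : ℕ) ≤ N := hcap j hj k τ hτ ((hltc' _ k τ hτ hτc').trans_le hc'T)
      have hkpos := k.pos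
      have hkk : (k.natPred).succPNat = k := PNat.succPNat_natPred k
      have hpred : k.natPred + 1 = k := PNat.natPred_add_one k
      have hpos : 0 < cellJump D N (j, l) :=
        lt_of_lt_of_le (Nat.succ_pos _) (le_largestJump (k := k.natPred) (by omega)
          (by rw [hkk]; exact (hcell k).2 ⟨τ, hτ, hcτ, hτc'⟩))
      rcases largestJump_eq_zero_or N fun k => epochCount (D (-(j : ℤ)) k) (l / 2 ^ N)
        ((l + 1) / 2 ^ N) with hz | ⟨k₀, hk₀, hcount, hG⟩
      · exact absurd hz hpos.ne'
      obtain ⟨τ₀, hτ₀, hcτ₀, hτ₀c'⟩ := (hcell _).1 hcount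
      have hτ₀T := (hltc' _ _ τ₀ hτ₀ hτ₀c').trans_le hc'T
      have huniq : ∀ j' ≤ m, ∀ k', ∀ τ' ∈ D (-(j' : ℤ)) k', c < τ' → τ' ≤ c' → τ' = τ₀ := by
        intro j' hj' k' τ' hτ' h1 h2
        have h3 := hltc' _ _ τ' hτ' h2
        refine hsep j' hj' j hj k' _ τ' hτ' τ₀ hτ₀ (h3.trans_le hc'T) hτ₀T ?_
        rw [abs_sub_lt_iff]
        constructor <;> linarith [hltc' _ _ τ₀ hτ₀ hτ₀c']
      have hG' : cellJump D N (j, l) = k₀ + 1 := hG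
      have hright : ∀ u, c ≤ u → u < τ₀ → σ (-(j : ℤ) + 1) u = σ (-(j : ℤ) + 1) c := by
        intro u hcu huτ
        cases j with
        | zero =>
          rw [hσ.eq_top hD h0 (by simp) (hc0.trans hcu), hσ.eq_top hD h0 (by simp) hc0]
        | succ j =>
          have e : -((j + 1 : ℕ) : ℤ) + 1 = -(j : ℤ) := by push_cast; ring
          rw [e]
          refine hσ.eq_of_forall_notMem hc0 hcu fun k' τ' hτ' h1 h2 => ?_
          have := huniq j (by omega) k' τ' hτ' h1 (by linarith)
          linarith
      have hmain := hσ.eq_min_of_single hc0 hcτ₀ hτ₀c' hτ₀ (huniq j hj) hright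
      have hk₀' : ((k₀.succPNat : ℕ+) : ℤ) = k₀ + 1 := by simp
      rw [hmain, ih j hj, hk₀']
      cases j with
      | zero =>
        rw [hσ.eq_top hD h0 (by simp) hc0, disp_zero_succ, hG']
        have : ((⊤ : WithTop ℤ) - 1) = ⊤ := rfl
        rw [this, min_eq_left le_top, ← WithTop.coe_add]
        congr 1
      | succ j =>
        have e : -((j + 1 : ℕ) : ℤ) + 1 = -(j : ℤ) := by push_cast; ring
        rw [e, ih j (by omega), disp_succ_succ, hG']
        have : ∀ z : ℤ, ((z : WithTop ℤ) - 1) = ((z - 1 : ℤ) : WithTop ℤ) := fun _ => rfl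
        rw [this, ← WithTop.coe_add, ← WithTop.coe_min]
        congr 1
        push_cast
        rw [← min_sub_sub_right]
        congr 1 <;> ring
    · have hzero : cellJump D N (j, l) = 0 := by
        refine Nat.le_zero.1 (largestJump_le fun k _ hk => ?_)
        obtain ⟨τ, hτ⟩ := (hcell _).1 hk
        exact absurd ⟨_, τ, hτ⟩ hex
      rw [hσ.eq_of_forall_notMem hc0 (by rw [hcc']; linarith) fun k τ hτ h1 h2 =>
        hex ⟨k, τ, hτ, h1, h2⟩, ih j hj]
      have : disp (cellJump D N) j (l + 1) = disp (cellJump D N) j l :=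
        le_antisymm ((disp_succ_le _ _ _).trans (by rw [hzero, add_zero]))
          (disp_mono_right _ _ l.le_succ)
      rw [this]

/-- At any time, the position of a particle is given by the discrete dynamics, once the mesh is
small enough. -/
lemma ObeysJumpRule.eventually_eq_disp_ceil (hσ : ObeysJumpRule D σ) (hD : RegularCommands D)
    (h0 : ∀ i, σ i 0 = stepConfig i) (m : ℕ) {t : ℝ} (ht : 0 ≤ t) :
    ∀ᶠ N : ℕ in atTop, σ (-(m : ℤ)) t
      = (((disp (cellJump D N) m ⌈t * 2 ^ N⌉₊ : ℤ) - m : ℤ) : WithTop ℤ) := by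
  obtain ⟨T, hT⟩ := exists_nat_ge t
  have hlim : Tendsto (fun N : ℕ => t + (1 / 2 : ℝ) ^ N) atTop (𝓝 (t + 0)) :=
    (tendsto_pow_atTop_nhds_zero_of_lt_one (by norm_num) (by norm_num)).const_add t
  rw [add_zero] at hlim
  have hfree : ∀ᶠ N : ℕ in atTop, ∀ τ ∈ {τ | ∃ k, τ ∈ D (-(m : ℤ)) k ∧ t < τ ∧ τ ≤ t + 1},
      t + (1 / 2 : ℝ) ^ N < τ :=
    (Set.Finite.eventually_all (hD.finite_times _ t (t + 1))).2
      fun τ ⟨_, _, h, _⟩ => hlim.eventually_lt_const h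
  filter_upwards [hσ.eventually_eq_disp hD h0 m T, hfree] with N hN hfree
  have h2N : (0 : ℝ) < 2 ^ N := by positivity
  have h1 : t ≤ ⌈t * 2 ^ N⌉₊ / 2 ^ N := by
    rw [le_div_iff₀ h2N]; exact Nat.le_ceil _
  have h2 : (⌈t * 2 ^ N⌉₊ : ℝ) / 2 ^ N ≤ t + (1 / 2) ^ N := by
    rw [div_le_iff₀ h2N, add_mul, ← mul_pow]
    have := (Nat.ceil_lt_add_one (by positivity : 0 ≤ t * 2 ^ N)).le
    norm_num
    exact this
  have h3 : (1 / 2 : ℝ) ^ N ≤ 1 := pow_le_one₀ (by norm_num) (by norm_num)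
  have hle : ⌈t * 2 ^ N⌉₊ ≤ 2 ^ N * T := by
    refine Nat.ceil_le.2 ?_
    push_cast
    rw [mul_comm]
    exact mul_le_mul_of_nonneg_left hT h2N.le
  rw [← hN _ hle m le_rfl]
  refine (hσ.eq_of_forall_notMem ht h1 fun k τ hτ h4 h5 => ?_).symm
  have := hfree τ ⟨k, hτ, h4, by linarith⟩
  linarith

end JumpRule

/-! ### The limit at real times -/

section RealTimes

variable {β : ℕ+ → ℝ≥0} {Ω : Type*} [MeasurableSpace Ω] {P : Measure Ω} {X : ℕ → ℝ → Ω → ℝ}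
  (hβ : Summable fun k : ℕ+ => ((k : ℕ) : ℝ) ^ 2 * (β k : ℝ))
  (hmono : ∀ᵐ ω ∂P, ∀ m s t, 0 ≤ s → s ≤ t → X m s ω ≤ X m t ω)
  (hanti : ∀ᵐ ω ∂P, ∀ m m' t, 0 ≤ t → m ≤ m' → X m' t ω ≤ X m t ω)
  {y t η : ℝ} {M : ℕ → ℕ}

include hβ hmono hanti in
lemma tendsto_measure_upper_real
    (htail : ∀ y b, 0 ≤ y → asympDisp β y < b →
      Tendsto (fun n : ℕ => P {ω | b * n < X ⌊y * n⌋₊ n ω}) atTop (𝓝 0))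
    (hy : 0 ≤ y) (ht : 0 < t) (hη : 0 < η) (hM : ∀ n : ℕ, y * (n * t) ≤ M n) :
    Tendsto (fun n : ℕ => P {ω | (asympDisp β y + η) * (n * t) < X (M n) (n * t) ω}) atTop
      (𝓝 0) := by
  obtain ⟨y', hy', hyy', hay'⟩ : ∃ y', 0 ≤ y' ∧ (y' = 0 ∨ y' < y) ∧
      asympDisp β y' < asympDisp β y + η := by
    rcases hy.eq_or_lt with rfl | hy0
    · exact ⟨0, le_rfl, Or.inl rfl, by linarith⟩
    · have hc : Tendsto (asympDisp β) (𝓝[<] y) (𝓝 (asympDisp β y)) :=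
        ((continuousOn_asympDisp hβ).continuousAt (Ici_mem_nhds hy0)).mono_left nhdsWithin_le_nhds
      obtain ⟨y', h1, h2⟩ := ((hc.eventually_lt_const (lt_add_of_pos_right _ hη)).and
        (Ioo_mem_nhdsLT hy0)).exists
      exact ⟨y', h2.1.le, Or.inr h2.2, h1⟩
  obtain ⟨b, hb1, hb2⟩ := exists_between hay'
  have hb0 : 0 ≤ b := le_trans (Real.sInf_nonneg (by
    rintro _ ⟨n, _, rfl⟩; exact div_nonneg (limMean_nonneg _ _) (Nat.cast_nonneg _))) hb1.le
  have hnt : Tendsto (fun n : ℕ => (n : ℝ) * t) atTop atTop :=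
    tendsto_natCast_atTop_atTop.atTop_mul_const ht
  have hfloor : Tendsto (fun n : ℕ => ⌊(n : ℝ) * t⌋₊ + 1) atTop atTop :=
    (tendsto_add_atTop_nat 1).comp (tendsto_nat_floor_atTop.comp hnt)
  refine tendsto_of_tendsto_of_tendsto_of_le_of_le' tendsto_const_nhds
    ((htail y' b hy' hb1).comp hfloor) (Eventually.of_forall fun _ => zero_le) ?_
  have hb2' : 0 < asympDisp β y + η - b := sub_pos.2 hb2
  have hlarge : ∀ᶠ n : ℕ in atTop, y' = 0 ∨ y' ≤ (y - y') * (n * t) := by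
    rcases hyy' with h | h
    · exact Eventually.of_forall fun _ => Or.inl h
    · exact ((hnt.const_mul_atTop (sub_pos.2 h)).eventually_ge_atTop y').mono fun _ => Or.inr
  filter_upwards [hlarge, (hnt.const_mul_atTop hb2').eventually_ge_atTop b] with n hn1 hn2
  set N := ⌊(n : ℝ) * t⌋₊ + 1
  have hnt0 : 0 ≤ (n : ℝ) * t := by positivity
  have hN1 : (n : ℝ) * t ≤ N := by
    push_cast [N]; exact (Nat.lt_floor_add_one _).le
  have hN2 : (N : ℝ) ≤ n * t + 1 := by
    push_cast [N]; linarith [Nat.floor_le hnt0]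
  have hindex : ⌊y' * N⌋₊ ≤ M n := by
    refine Nat.floor_le_of_le (le_trans ?_ (hM n))
    rcases hn1 with h | h
    · rw [h, zero_mul]; positivity
    · nlinarith
  refine measure_mono_ae ?_
  filter_upwards [hmono, hanti] with ω h1 h2 h
  have h3 : (asympDisp β y + η) * (n * t) < X (M n) (n * t) ω := h
  have h4 := h1 (M n) (n * t) N hnt0 hN1
  have h5 := h2 _ _ (N : ℝ) (Nat.cast_nonneg _) hindex
  show b * N < X ⌊y' * N⌋₊ N ω
  nlinarith

include hβ hmono hanti in
lemma tendsto_measure_lower_real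
    (htail : ∀ y b, 0 ≤ y → b < asympDisp β y →
      Tendsto (fun n : ℕ => P {ω | X ⌊y * n⌋₊ n ω < b * n}) atTop (𝓝 0))
    (hy : 0 ≤ y) (ht : 0 < t) (hη : 0 < η) (hM : ∀ n : ℕ, M n ≤ y * (n * t) + 1) :
    Tendsto (fun n : ℕ => P {ω | X (M n) (n * t) ω < (asympDisp β y - η) * (n * t)}) atTop
      (𝓝 0) := by
  obtain ⟨y', hyy', hay'⟩ : ∃ y', y < y' ∧ asympDisp β y - η < asympDisp β y' := by
    have hc : Tendsto (asympDisp β) (𝓝[>] y) (𝓝 (asympDisp β y)) :=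
      (continuousOn_asympDisp hβ y hy).mono_left
        (nhdsWithin_mono y fun z hz => hy.trans (le_of_lt hz))
    obtain ⟨y', h1, h2⟩ := ((hc.eventually_const_lt (sub_lt_self _ hη)).and
      self_mem_nhdsWithin).exists
    exact ⟨y', h2, h1⟩
  have hy' : 0 ≤ y' := hy.trans hyy'.le
  obtain ⟨b, hb1, hb2⟩ := exists_between hay'
  have hnt : Tendsto (fun n : ℕ => (n : ℝ) * t) atTop atTop :=
    tendsto_natCast_atTop_atTop.atTop_mul_const ht
  refine tendsto_of_tendsto_of_tendsto_of_le_of_le' tendsto_const_nhds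
    ((htail y' b hy' hb2).comp (tendsto_nat_floor_atTop.comp hnt))
    (Eventually.of_forall fun _ => zero_le) ?_
  have hb1' : 0 < b - (asympDisp β y - η) := sub_pos.2 hb1
  filter_upwards [(hnt.const_mul_atTop (sub_pos.2 hyy')).eventually_ge_atTop (y' + 1),
    (hnt.const_mul_atTop hb1').eventually_ge_atTop |b|] with n hn1 hn2
  set N := ⌊(n : ℝ) * t⌋₊
  have hnt0 : 0 ≤ (n : ℝ) * t := by positivity
  have hN1 : (N : ℝ) ≤ n * t := Nat.floor_le hnt0
  have hN2 : (n : ℝ) * t ≤ N + 1 := (Nat.lt_floor_add_one _).le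
  have hindex : M n ≤ ⌊y' * N⌋₊ := by
    refine Nat.le_floor ((hM n).trans ?_)
    nlinarith
  have hbN : (asympDisp β y - η) * (n * t) ≤ b * N := by
    have h1 : |b| * (n * t - N) ≤ |b| :=
      mul_le_of_le_one_right (abs_nonneg b) (by linarith)
    have h2 : b * (n * t - N) ≤ |b| * (n * t - N) :=
      mul_le_mul_of_nonneg_right (le_abs_self b) (by linarith)
    nlinarith
  refine measure_mono_ae ?_
  filter_upwards [hmono, hanti] with ω h1 h2 h
  have h3 : X (M n) (n * t) ω < (asympDisp β y - η) * (n * t) := h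
  have h4 := h1 (M n) N (n * t) (Nat.cast_nonneg _) hN1
  have h5 := h2 _ _ (N : ℝ) (Nat.cast_nonneg _) hindex
  show X ⌊y' * N⌋₊ N ω < b * N
  linarith

end RealTimes

/-! ### The exclusion process -/

section Exclusion

variable {β : ℕ+ → ℝ≥0} {Ω : Type*} [MeasurableSpace Ω] {P : Measure Ω}
  {D : ℤ → ℕ+ → Ω → Set ℝ} {ξ : ℤ → ℝ → Ω → WithTop ℤ}

lemma IsJumpCommands.ae_regularCommands [IsProbabilityMeasure P] (hD : IsJumpCommands P β D)
    (hβ : Summable fun k => (β k : ℝ)) : ∀ᵐ ω ∂P, RegularCommands fun i k => D i k ω := by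
  have hB : Summable β := NNReal.summable_coe.1 hβ
  set B : ℝ≥0 := ∑' k, β k
  set h : ℝ≥0 := 2⁻¹ / (B + 1) with hh
  have hh0 : 0 < h := by positivity
  have hBh : (∑' k, (β k : ℝ≥0∞)) * h ≤ 2⁻¹ := by
    rw [← ENNReal.coe_tsum hB, ← ENNReal.coe_mul, ← ENNReal.coe_ofNat,
      ← ENNReal.coe_inv two_ne_zero,
      ENNReal.coe_le_coe, hh, mul_div_assoc', div_le_iff₀ (by positivity), mul_comm]
    gcongr
    exact le_self_add
  have hquiet : ∀ᵐ ω ∂P, ∀ (w : ℕ) (j : ℤ), ∃ i, j ≤ i ∧ ∀ k,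
      Disjoint (D i k ω) (Ico (w * ((h / 2 : ℝ≥0) : ℝ)) (w * ((h / 2 : ℝ≥0) : ℝ)
        + 2 * ((h / 2 : ℝ≥0) : ℝ))) := by
    simp only [ae_all_iff]
    intro w j
    have := hD.ae_exists_quiet (w * (h / 2)) h hBh j
    have e : 2 * ((h / 2 : ℝ≥0) : ℝ) = h := by push_cast; ring
    rw [e]
    simpa only [NNReal.coe_mul, NNReal.coe_natCast] using this
  filter_upwards [hD.ae_finite_epochs hβ, hD.ae_notMem_dyadic, hquiet] with ω h1 h2 h3
  exact ⟨h1, h2, _, by positivity, h3⟩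

/-- Almost surely, the discrete dynamics driven by the commands gives the position of each particle
at each time, once the mesh is small enough. -/
lemma IsStepProcess.ae_eventually_eq [IsProbabilityMeasure P] (hD : IsJumpCommands P β D)
    (hβ : Summable fun k => (β k : ℝ)) (hξ : IsStepProcess P D ξ) :
    ∀ᵐ ω ∂P, ∀ (m : ℕ) (t : ℝ), 0 ≤ t → ∀ᶠ N : ℕ in atTop, ξ (-(m : ℤ)) t ω
      = (((disp (cellJump (fun i k => D i k ω) N) m ⌈t * 2 ^ N⌉₊ : ℤ) - m : ℤ) : WithTop ℤ) := by
  filter_upwards [hD.ae_regularCommands hβ, hξ] with ω h1 h2 m t ht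
  exact h2.1.eventually_eq_disp_ceil h1 h2.2 m ht

end Exclusion

end

theorem lemma3 (β : ℕ+ → ℝ≥0) (hβ : Summable fun k : ℕ+ => ((k : ℕ) : ℝ) ^ 2 * (β k : ℝ)) :
    ∃ g : ℝ → ℝ, ContinuousOn g (Iic 0) ∧ ConvexOn ℝ (Iic 0) g ∧
      ∀ (Ω : Type*) [MeasurableSpace Ω] (P : Measure Ω) [IsProbabilityMeasure P]
        (D : ℤ → ℕ+ → Ω → Set ℝ) (ξ : ℤ → ℝ → Ω → WithTop ℤ),
        IsJumpCommands P β D → IsStepProcess P D ξ →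
          (∀ᵐ ω ∂P, ∀ i : ℤ, i ≤ 0 → ∀ t : ℝ, 0 ≤ t → ξ i t ω ≠ ⊤) ∧
          ∀ x t : ℝ, x ≤ 0 → 0 < t →
            TendstoInMeasure P
              (fun (n : ℕ) ω => (n : ℝ)⁻¹ * location (ξ ⌊(n : ℝ) * x⌋ ((n : ℝ) * t) ω))
              atTop (fun _ => t * g (x / t)) := by
  have hneg : MapsTo (fun x : ℝ => -x) (Iic 0) (Ici 0) := fun x hx =>
    show (0 : ℝ) ≤ -x from neg_nonneg.2 hx
  have hβ' : Summable fun k => (β k : ℝ) :=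
    Summable.of_nonneg_of_le (fun k => (β k).2) (fun k => le_mul_of_one_le_left (β k).2
      (one_le_pow₀ (by exact_mod_cast k.pos))) hβ
  refine ⟨fun x => x + asympDisp β (-x), ?_, ?_, ?_⟩
  · exact continuousOn_id.add ((continuousOn_asympDisp hβ).comp continuousOn_neg hneg)
  · refine (convexOn_id (convex_Iic 0)).add ?_
    have h := (convexOn_asympDisp hβ).comp_linearMap (-LinearMap.id : ℝ →ₗ[ℝ] ℝ)
    refine h.subset (fun x hx => ?_) (convex_Iic 0)
    simpa using hx
  intro Ω _ P _ D ξ hD hξ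
  have hmain := hξ.ae_eventually_eq hD hβ'
  refine ⟨?_, fun x t hx ht => ?_⟩
  · filter_upwards [hmain] with ω hω i hi t ht
    obtain ⟨m, rfl⟩ : ∃ m : ℕ, i = -m := ⟨i.natAbs, by omega⟩
    obtain ⟨N, hN⟩ := (hω m t ht).exists
    rw [hN]
    exact WithTop.coe_ne_top
  set X : ℕ → ℝ → Ω → ℝ := fun m s ω => location (ξ (-(m : ℤ)) s ω) + m with hXdef
  have hX : ∀ᵐ ω ∂P, ∀ m s, 0 ≤ s → ∀ᶠ N : ℕ in atTop,
      X m s ω = disp (cellJump (fun i k => D i k ω) N) m ⌈s * 2 ^ N⌉₊ := by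
    filter_upwards [hmain] with ω hω m s hs
    filter_upwards [hω m s hs] with N hN
    simp only [hXdef, location, hN, WithTop.untopD_coe]
    push_cast
    ring
  have hmono : ∀ᵐ ω ∂P, ∀ m s t, 0 ≤ s → s ≤ t → X m s ω ≤ X m t ω := by
    filter_upwards [hX] with ω hω m s t hs hst
    obtain ⟨N, h1, h2⟩ := ((hω m s hs).and (hω m t (hs.trans hst))).exists
    rw [h1, h2]
    exact_mod_cast disp_mono_right _ m (Nat.ceil_le_ceil (by gcongr))
  have hanti : ∀ᵐ ω ∂P, ∀ m m' t, 0 ≤ t → m ≤ m' → X m' t ω ≤ X m t ω := by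
    filter_upwards [hX] with ω hω m m' t ht hm
    obtain ⟨N, h1, h2⟩ := ((hω m t ht).and (hω m' t ht)).exists
    rw [h1, h2]
    exact_mod_cast disp_antitone_left _ _ hm
  set Y : ℕ → ℕ → Ω → ℕ := fun m n ω => ⌊X m n ω⌋₊
  have hY : ∀ᵐ ω ∂P, ∀ m n, ∀ᶠ N in atTop,
      Y m n ω = disp (cellJump (fun i k => D i k ω) N) m (2 ^ N * n) := by
    filter_upwards [hX] with ω hω m n
    filter_upwards [hω m n (Nat.cast_nonneg n)] with N hN
    have e : ⌈(n : ℝ) * 2 ^ N⌉₊ = 2 ^ N * n := by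
      rw [mul_comm]; exact_mod_cast Nat.ceil_natCast (2 ^ N * n)
    simp only [Y, hN, e, Nat.floor_natCast]
  have hYX : ∀ᵐ ω ∂P, ∀ m n : ℕ, X m n ω = Y m n ω := by
    filter_upwards [hX] with ω hω m n
    obtain ⟨N, hN⟩ := (hω m n (Nat.cast_nonneg n)).exists
    simp only [Y, hN, Nat.floor_natCast]
  have hupper : ∀ y b, 0 ≤ y → asympDisp β y < b →
      Tendsto (fun n : ℕ => P {ω | b * n < X ⌊y * n⌋₊ n ω}) atTop (𝓝 0) := by
    intro y b hy hb
    refine (tendsto_measure_upper_tail hβ hD.measurePreserving_cellJump hY hy hb).congr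
      fun n => ?_
    refine measure_congr ?_
    filter_upwards [hYX] with ω hω
    show (b * n < (Y ⌊y * n⌋₊ n ω : ℝ)) = (b * n < X ⌊y * n⌋₊ n ω)
    rw [hω]
  have hlower : ∀ y b, 0 ≤ y → b < asympDisp β y →
      Tendsto (fun n : ℕ => P {ω | X ⌊y * n⌋₊ n ω < b * n}) atTop (𝓝 0) := by
    intro y b hy hb
    refine (tendsto_measure_lower_tail hβ (hD.measurePreserving_cellJump) hY
      (fun ω N m n => disp_cellJump_le_succ _ N m n) hy hb).congr fun n => ?_
    refine measure_congr ?_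
    filter_upwards [hYX] with ω hω
    show ((Y ⌊y * n⌋₊ n ω : ℝ) < b * n) = (X ⌊y * n⌋₊ n ω < b * n)
    rw [hω]
  set y := -(x / t) with hydef
  have hy : 0 ≤ y := neg_nonneg.2 (div_nonpos_of_nonpos_of_nonneg hx ht.le)
  have hyt : ∀ n : ℕ, y * (n * t) = -(n * x) := fun n => by
    rw [hydef]; field_simp
  set M : ℕ → ℕ := fun n => (-⌊(n : ℝ) * x⌋).toNat
  have hfl : ∀ n : ℕ, ⌊(n : ℝ) * x⌋ = -(M n : ℤ) := fun n => by
    have : ⌊(n : ℝ) * x⌋ ≤ 0 :=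
      Int.floor_nonpos (mul_nonpos_of_nonneg_of_nonpos (Nat.cast_nonneg n) hx)
    simp only [M]
    omega
  have hflR : ∀ n : ℕ, (⌊(n : ℝ) * x⌋ : ℝ) = -(M n : ℝ) := fun n => by
    rw [hfl n]; push_cast; rfl
  have hM1 : ∀ n : ℕ, y * (n * t) ≤ M n := fun n => by
    have := Int.floor_le ((n : ℝ) * x)
    rw [hflR] at this
    rw [hyt]
    linarith
  have hM2 : ∀ n : ℕ, M n ≤ y * (n * t) + 1 := fun n => by
    have := (Int.lt_floor_add_one ((n : ℝ) * x)).le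
    rw [hflR] at this
    rw [hyt]
    linarith
  rw [tendstoInMeasure_iff_dist]
  intro ε hε
  have hη : 0 < ε / (2 * t) := by positivity
  have hsum := (tendsto_measure_upper_real hβ hmono hanti hupper hy ht hη hM1).add
    (tendsto_measure_lower_real hβ hmono hanti hlower hy ht hη hM2)
  rw [add_zero] at hsum
  refine tendsto_of_tendsto_of_tendsto_of_le_of_le' tendsto_const_nhds hsum
    (Eventually.of_forall fun _ => zero_le) ?_
  filter_upwards [(tendsto_natCast_atTop_atTop (R := ℝ)).eventually_gt_atTop (2 / ε)] with n hn
  have hn0 : (0 : ℝ) < n := lt_trans (by positivity) hn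
  rw [div_lt_iff₀ hε] at hn
  refine (measure_mono fun ω hω => ?_).trans (measure_union_le _ _)
  by_contra hcon
  have hu : X (M n) (n * t) ω ≤ (asympDisp β y + ε / (2 * t)) * (n * t) :=
    not_lt.1 fun h => hcon (Or.inl h)
  have hl : (asympDisp β y - ε / (2 * t)) * (n * t) ≤ X (M n) (n * t) ω :=
    not_lt.1 fun h => hcon (Or.inr h)
  have hω' : ε ≤ dist ((n : ℝ)⁻¹ * location (ξ ⌊(n : ℝ) * x⌋ ((n : ℝ) * t) ω))
      (t * (x / t + asympDisp β (-(x / t)))) := hω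
  have hloc : location (ξ ⌊(n : ℝ) * x⌋ ((n : ℝ) * t) ω) = X (M n) (n * t) ω - M n := by
    rw [hfl]; simp [hXdef]
  rw [hloc, ← hydef, Real.dist_eq] at hω'
  refine absurd hω' (not_le.2 ?_)
  have h1 := hM1 n
  have h2 := hM2 n
  rw [hyt] at h1 h2
  have e1 : ε / (2 * t) * (n * t) = n * ε / 2 := by field_simp
  have e2 : (n : ℝ)⁻¹ * (X (M n) (n * t) ω - M n) - t * (x / t + asympDisp β y)
      = (X (M n) (n * t) ω - asympDisp β y * (n * t) - (M n + n * x)) / n := by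
    field_simp
    ring
  rw [add_mul, e1] at hu
  rw [sub_mul, e1] at hl
  rw [e2, abs_lt, lt_div_iff₀ hn0, div_lt_iff₀ hn0]
  constructor <;> nlinarith
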